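/- Let $n\ge 1$. Let $X,Y,Z$ be the single-qubit Pauli operators; for $x=(a,b)\in\mathbb F_2^n\times\mathbb F_2^n$ let $W_x=i^{\sum_i a_ib_i}\,(X^{a_1}Z^{b_1})\otimes\cdots\otimes(X^{a_n}Z^{b_n})$ (the exponent of $i$ is computed in $\mathbb Z$), and let $[x,y]=\sum_i (a_ib'_i+b_ia'_i)\in\mathbb F_2$ for $x=(a,b)$, $y=(a',b')$. The operators $W_x$ are exactly the tensor products of $n$ operators from $\{I,X,Y,Z\}$. Two of them commute locally if, at each qubit, their tensor factors commute. Let $\mathcal{SP}=\{|0\rangle,|1\rangle,|+\rangle,|-\rangle,|i\rangle,|-i\rangle\}^{\otimes n}$ be the set of $n$-qubit stabilizer product states. A stabilizer product group is a set $\{I,P_1\}\otimes\cdots\otimes\{I,P_n\}$ with $P_1,\dots,P_n\in\{X,Y,Z\}$; its basis is the orthonormal basis of the $2^n$ states in $\mathcal{SP}$ whose $i$-th tensor factor is an eigenvector of $P_i$ for each $i$. The local span of a set $V$ of pairwise locally commuting operators $W_x$ is $\{I,Q_1\}\otimes\cdots\otimes\{I,Q_n\}$, where $Q_i$ is the unique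 non-identity operator that occurs at qubit $i$ in $V$, and $Q_i=I$ if there is none. Bell difference sampling on an $n$-qubit mixed state $\rho$ returns $x\in\mathbb F_2^{2n}$ with probability $q_\rho(x)=\mathrm{tr}(\Pi_x\rho^{\otimes 4})$, where $\Pi_x=4^{-n}\sum_{a\in\mathbb F_2^{2n}}(-1)^{[x,a]}W_a^{\otimes 4}$. Let $0<\varepsilon\le\tau<1$, $\tfrac12<p<1$, $0<\delta<1$, and put $$m_{\mathsf{outer}}=\lceil\log_{3/4}(\delta/2)\rceil,\quad k=\Big\lceil\log_p\tfrac1{2n}\Big\rceil,\quad m_{\mathsf{clique}}=\Big\lceil\tfrac{k+1}{\tau^4}\Big\rceil,\quad t=\frac{4\log_2(1/\tau)}{1-\mathsf H(p)},$$ $$m_{\mathsf{est}}=\left\lceil\frac{8\ln\!\big(4\,m_{\mathsf{outer}}\binom{m_{\mathsf{clique}}}{k}3^t/\delta\big)}{\varepsilon^2}\right\rceil,\qquad \mathsf H(p)=-p\log_2p-(1-p)\log_2(1-p).$$ Consider the following algorithm, which receives copies of $\rho$. Repeat $m_{\mathsf{outer}}$ times: take $m_{\mathsf{clique}}$ independent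 Bell difference samples from $\rho$, and form the graph that has one vertex for each sample and an edge between any two distinct vertices whose samples commute locally. For each clique of size $k$ in this graph, compute the local span $S$ of the samples in the clique, and if $\log_2|S|\ge n-t$, then for each stabilizer product group $\overline S\supseteq S$ measure $m_{\mathsf{est}}$ fresh copies of $\rho$ in the basis of $\overline S$, and let $\hat o_\phi$ be the fraction of these measurements with outcome $|\phi\rangle$, for each $|\phi\rangle$ in this basis. Finally, output a state $|\phi\rangle$ whose recorded estimate $\hat o_\phi$ is the largest among all the estimates recorded (ties are broken by an arbitrary rule; if nothing was recorded, the output is an arbitrary element of $\mathcal{SP}$). **Corollary.** Let $\rho$ be an $n$-qubit mixed state such that $\langle\phi'|\rho|\phi'\rangle\ge\tau$ for some $|\phi'\rangle\in\mathcal{SP}$. Then, with probability at least $1-\delta$, the algorithm outputs a stabilizer product state $|\phi\rangle\in\mathcal{SP}$ with $$\langle\phi|\rho|\phi\rangle\ \ge\ \max_{\phi'\in\mathcal{SP}}\langle\phi'|\rho|\phi'\rangle-\varepsilon .$$ -/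

import Mathlib

open Matrix BigOperators

noncomputable section

namespace StabProd

open scoped ComplexOrder

/-! ### Tensor products of matrices -/

/-- The tensor product `⨂ i, M i` of a finite family of square matrices. The computational basis of
the tensor product is indexed by the functions `κ → ι`. -/
def tensor {ι κ : Type} [Fintype κ] (M : κ → Matrix ι ι ℂ) : Matrix (κ → ι) (κ → ι) ℂ :=
  Matrix.of fun u v => ∏ i, M i (u i) (v i)

/-- The tensor product `⨂ i, ψ i` of a finite family of vectors. -/
def tensorVec {ι κ : Type} [Fintype κ] (ψ : κ → ι → ℂ) : (κ → ι) → ℂ := fun u => ∏ i, ψ i (u i)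

theorem tensor_mul {ι κ : Type} [Fintype ι] [Fintype κ] [DecidableEq κ]
    (M N : κ → Matrix ι ι ℂ) :
    tensor M * tensor N = tensor (fun i => M i * N i) := by
  ext u v
  simp only [tensor, Matrix.mul_apply, Matrix.of_apply, Fintype.prod_sum, Finset.prod_mul_distrib]

theorem tensor_conjTranspose {ι κ : Type} [Fintype κ] (M : κ → Matrix ι ι ℂ) :
    (tensor M)ᴴ = tensor (fun i => (M i)ᴴ) := by
  ext u v
  simp [tensor, Matrix.conjTranspose_apply]

theorem tensor_one {ι κ : Type} [DecidableEq ι] [Fintype κ] [DecidableEq κ] :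
    tensor (fun _ : κ => (1 : Matrix ι ι ℂ)) = 1 := by
  ext u v
  simp only [tensor, Matrix.of_apply, Matrix.one_apply, Finset.prod_ite_zero, Finset.prod_const_one,
    Finset.mem_univ, true_implies, funext_iff]

theorem tensor_smul {ι κ : Type} [Fintype κ] (c : κ → ℂ) (M : κ → Matrix ι ι ℂ) :
    tensor (fun i => c i • M i) = (∏ i, c i) • tensor M := by
  ext u v
  simp [tensor, Finset.prod_mul_distrib]

theorem trace_tensor {ι κ : Type} [Fintype ι] [Fintype κ] [DecidableEq κ]
    (M : κ → Matrix ι ι ℂ) :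
    (tensor M).trace = ∏ i, (M i).trace := by
  simp only [Matrix.trace, Matrix.diag, tensor, Matrix.of_apply, Fintype.prod_sum]

/-! ### Density matrices and measurements -/

/-- A mixed state on a finite-dimensional system with computational basis `ι`. -/
structure Density (ι : Type) [Fintype ι] where
  mat : Matrix ι ι ℂ
  posSemidef : mat.PosSemidef
  trace_eq_one : mat.trace = 1

open scoped MatrixOrder in
theorem exists_factor {ι : Type} [Fintype ι] [DecidableEq ι] {A : Matrix ι ι ℂ}
    (hA : A.PosSemidef) : ∃ B : Matrix ι ι ℂ, A = Bᴴ * B :=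
  CStarAlgebra.nonneg_iff_eq_star_mul_self.mp hA.nonneg

/-- The state `ρ ^ ⊗ m` of `m` copies of `ρ`. -/
def Density.copies {ι : Type} [Fintype ι] [DecidableEq ι] (ρ : Density ι) (m : ℕ) :
    Density (Fin m → ι) where
  mat := tensor fun _ : Fin m => ρ.mat
  posSemidef := by
    obtain ⟨B, hB⟩ := exists_factor ρ.posSemidef
    rw [hB, ← tensor_mul, ← tensor_conjTranspose]
    exact Matrix.posSemidef_conjTranspose_mul_self _
  trace_eq_one := by rw [trace_tensor]; simp [ρ.trace_eq_one]

/-- A measurement with outcomes in a finite set `α`: positive semidefinite effects that sum to the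
identity. -/
structure Measurement (ι α : Type) [Fintype ι] [DecidableEq ι] [Fintype α] where
  effect : α → Matrix ι ι ℂ
  posSemidef : ∀ x, (effect x).PosSemidef
  sum_eq_one : ∑ x, effect x = 1

theorem born_nonneg {ι : Type} [Fintype ι] [DecidableEq ι] {E A : Matrix ι ι ℂ}
    (hE : E.PosSemidef) (hA : A.PosSemidef) : 0 ≤ (E * A).trace.re := by
  obtain ⟨B, rfl⟩ := exists_factor hE
  rw [Matrix.mul_assoc, Matrix.trace_mul_comm]
  exact (Complex.le_def.mp (hA.mul_mul_conjTranspose_same B).trace_nonneg).1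

/-- The distribution of the outcome when `ρ` is measured (Born rule): the outcome `x` has
probability `tr (E_x ρ)`. -/
def Measurement.outcome {ι α : Type} [Fintype ι] [DecidableEq ι] [Fintype α]
    (E : Measurement ι α) (ρ : Density ι) : PMF α :=
  PMF.ofFintype (fun x => ENNReal.ofReal (E.effect x * ρ.mat).trace.re) (by
    rw [← ENNReal.ofReal_sum_of_nonneg
        fun x _ => born_nonneg (E.posSemidef x) ρ.posSemidef,
      ← Complex.re_sum, ← Matrix.trace_sum, ← Finset.sum_mul, E.sum_eq_one, Matrix.one_mul,
      ρ.trace_eq_one]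
    simp)

/-! ### Pauli (Weyl) operators -/

/-- Computational basis labels of `n` qubits. -/
abbrev Qubits (n : ℕ) : Type := Fin n → Fin 2

/-- `𝔽₂²ⁿ`, as the set of pairs `(a, b)` with `a, b ∈ 𝔽₂ⁿ`; the labels of the `n`-qubit (unsigned)
Pauli operators. -/
abbrev F2 (n : ℕ) : Type := (Fin n → ZMod 2) × (Fin n → ZMod 2)

def pauliX : Matrix (Fin 2) (Fin 2) ℂ := !![0, 1; 1, 0]

def pauliZ : Matrix (Fin 2) (Fin 2) ℂ := !![1, 0; 0, -1]

/-- The single-qubit Pauli operator `i^(a b) X^a Z^b`: it is `I`, `X`, `Z`, `Y` for `(a, b)` equal to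
`(0, 0)`, `(1, 0)`, `(0, 1)`, `(1, 1)`. -/
def pauli (c : ZMod 2 × ZMod 2) : Matrix (Fin 2) (Fin 2) ℂ :=
  Complex.I ^ (c.1.val * c.2.val) • (pauliX ^ c.1.val * pauliZ ^ c.2.val)

/-- The label of the `i`-th tensor factor of the Pauli operator with label `x`. -/
def F2.at {n : ℕ} (x : F2 n) (i : Fin n) : ZMod 2 × ZMod 2 := (x.1 i, x.2 i)

/-- The Weyl operator `W_x = i^(a ⬝ b) (X^(a₁) Z^(b₁)) ⊗ ⋯ ⊗ (X^(aₙ) Z^(bₙ))`, `x = (a, b)`. -/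
def weyl {n : ℕ} (x : F2 n) : Matrix (Qubits n) (Qubits n) ℂ :=
  Complex.I ^ (∑ i, (x.1 i).val * (x.2 i).val) •
    tensor fun i => pauliX ^ (x.1 i).val * pauliZ ^ (x.2 i).val

/-- The symplectic product on `𝔽₂²ⁿ`. -/
def symp {n : ℕ} (x y : F2 n) : ZMod 2 := ∑ i, (x.1 i * y.2 i + x.2 i * y.1 i)

/-- The sign `(-1)^c` for `c ∈ 𝔽₂`. -/
def sign (c : ZMod 2) : ℂ := (-1) ^ c.val

theorem weyl_eq {n : ℕ} (x : F2 n) : weyl x = tensor fun i => pauli (x.at i) := by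
  simp only [weyl, pauli, F2.at, tensor_smul, Finset.prod_pow_eq_pow_sum]

theorem pauli_conjTranspose (c : ZMod 2 × ZMod 2) : (pauli c)ᴴ = pauli c := by
  obtain ⟨a, b⟩ := c
  fin_cases a <;> fin_cases b <;> ext i j <;> fin_cases i <;> fin_cases j <;>
    simp [pauli, pauliX, pauliZ, ZMod.val]

theorem pauli_mul (c d : ZMod 2 × ZMod 2) :
    ∃ z : ℂ, z ^ 4 = 1 ∧ pauli c * pauli d = z • pauli (c + d) := by
  have h2 : (1 : ZMod 2) + 1 = 0 := by decide
  have hv0 : (0 : ZMod 2).val = 0 := rfl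
  have hv1 : (1 : ZMod 2).val = 1 := rfl
  have h4 : ∀ z : ℂ, z = 1 ∨ z = -1 ∨ z = Complex.I ∨ z = -Complex.I → z ^ 4 = 1 := by
    rintro z (rfl | rfl | rfl | rfl) <;> simp [Complex.I_pow_four, Even.neg_pow (n := 4) (by decide)]
  obtain ⟨a, b⟩ := c
  obtain ⟨a', b'⟩ := d
  have hz : ∀ a : ZMod 2, a = 0 ∨ a = 1 := by decide
  rcases hz a with rfl | rfl <;> rcases hz b with rfl | rfl <;>
    rcases hz a' with rfl | rfl <;> rcases hz b' with rfl | rfl <;>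
    first
    | (refine ⟨1, h4 _ (by simp), ?_⟩
       ext i j
       fin_cases i <;> fin_cases j <;>
         simp [pauli, pauliX, pauliZ, hv0, hv1, h2] <;> done)
    | (refine ⟨-1, h4 _ (by simp), ?_⟩
       ext i j
       fin_cases i <;> fin_cases j <;>
         simp [pauli, pauliX, pauliZ, hv0, hv1, h2] <;> done)
    | (refine ⟨Complex.I, h4 _ (by simp), ?_⟩
       ext i j
       fin_cases i <;> fin_cases j <;>
         simp [pauli, pauliX, pauliZ, hv0, hv1, h2] <;> done)
    | (refine ⟨-Complex.I, h4 _ (by simp), ?_⟩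
       ext i j
       fin_cases i <;> fin_cases j <;>
         simp [pauli, pauliX, pauliZ, hv0, hv1, h2])

/-- The operator `W_a ^ ⊗ 4`. -/
def weyl4 {n : ℕ} (a : F2 n) : Matrix (Fin 4 → Qubits n) (Fin 4 → Qubits n) ℂ :=
  tensor fun _ : Fin 4 => weyl a

theorem weyl4_conjTranspose {n : ℕ} (a : F2 n) : (weyl4 a)ᴴ = weyl4 a := by
  simp only [weyl4, tensor_conjTranspose, weyl_eq, pauli_conjTranspose]

theorem weyl4_mul {n : ℕ} (a b : F2 n) : weyl4 a * weyl4 b = weyl4 (a + b) := by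
  choose z hz hmul using fun i : Fin n => pauli_mul (a.at i) (b.at i)
  have h : weyl a * weyl b = (∏ i, z i) • weyl (a + b) := by
    simp only [weyl_eq, tensor_mul, hmul, tensor_smul]
    rfl
  simp only [weyl4, tensor_mul, h, tensor_smul]
  rw [Finset.prod_const, Finset.card_univ, Fintype.card_fin, ← Finset.prod_pow]
  simp [hz]

theorem weyl4_zero {n : ℕ} : weyl4 (0 : F2 n) = 1 := by
  have h : weyl (0 : F2 n) = 1 := by simp [weyl, tensor_one]
  simp only [weyl4, h, tensor_one]

theorem sign_add (c d : ZMod 2) : sign (c + d) = sign c * sign d := by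
  have h2 : (1 : ZMod 2) + 1 = 0 := by decide
  have hz : ∀ a : ZMod 2, a = 0 ∨ a = 1 := by decide
  have hv1 : (1 : ZMod 2).val = 1 := rfl
  rcases hz c with rfl | rfl <;> rcases hz d with rfl | rfl <;> simp [sign, h2, hv1]

theorem symp_add_right {n : ℕ} (x a b : F2 n) : symp x (a + b) = symp x a + symp x b := by
  simp only [symp, ← Finset.sum_add_distrib]
  refine Finset.sum_congr rfl fun i _ => ?_
  simp only [Prod.fst_add, Prod.snd_add, Pi.add_apply]
  ring

theorem symp_comm {n : ℕ} (x a : F2 n) : symp x a = symp a x := by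
  simp only [symp]
  refine Finset.sum_congr rfl fun i _ => ?_
  ring

theorem sum_sign_symp {n : ℕ} (a : F2 n) :
    ∑ x : F2 n, sign (symp x a) = if a = 0 then 4 ^ n else 0 := by
  split_ifs with h
  · subst h
    have h1 : Fintype.card (F2 n) = 4 ^ n := by
      simp [F2, ZMod.card, ← mul_pow]
    simp [symp, sign, h1]
  · obtain ⟨y, hy⟩ : ∃ y : F2 n, symp y a = 1 := by
      have hz : ∀ c : ZMod 2, c ≠ 0 → c = 1 := by decide
      by_contra! hcon
      apply h
      ext i
      · by_contra hi
        refine hcon (0, Pi.single i 1) ?_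
        simpa [symp, Pi.single_apply] using hz _ hi
      · by_contra hi
        refine hcon (Pi.single i 1, 0) ?_
        simpa [symp, Pi.single_apply] using hz _ hi
    have hs : ∑ x : F2 n, sign (symp x a) = ∑ x : F2 n, sign (symp (x + y) a) :=
      (Equiv.sum_comp (Equiv.addRight y) fun x => sign (symp x a)).symm
    have hv1 : (1 : ZMod 2).val = 1 := rfl
    have hneg : ∀ x : F2 n, sign (symp (x + y) a) = -sign (symp x a) := by
      intro x
      rw [symp_comm, symp_add_right, symp_comm a y, hy, symp_comm a x, sign_add]
      simp [sign, hv1]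
    simp only [hneg, Finset.sum_neg_distrib] at hs
    exact self_eq_neg.mp hs

/-! ### Bell difference sampling -/

/-- The projector `Π_x = 4⁻ⁿ ∑_a (-1)^[x, a] W_a ^ ⊗ 4`. -/
def bellEffect {n : ℕ} (x : F2 n) : Matrix (Fin 4 → Qubits n) (Fin 4 → Qubits n) ℂ :=
  (1 / 4 ^ n : ℂ) • ∑ a : F2 n, sign (symp x a) • weyl4 a

theorem bellEffect_conjTranspose {n : ℕ} (x : F2 n) : (bellEffect x)ᴴ = bellEffect x := by
  simp [bellEffect, Matrix.conjTranspose_smul, Matrix.conjTranspose_sum, weyl4_conjTranspose, sign]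

theorem bellEffect_mul_self {n : ℕ} (x : F2 n) : bellEffect x * bellEffect x = bellEffect x := by
  have h : (∑ a : F2 n, sign (symp x a) • weyl4 a) * (∑ a : F2 n, sign (symp x a) • weyl4 a)
      = (4 ^ n : ℂ) • ∑ a : F2 n, sign (symp x a) • weyl4 a := by
    rw [Finset.sum_mul_sum]
    have : ∀ a : F2 n, ∑ b : F2 n, (sign (symp x a) • weyl4 a) * (sign (symp x b) • weyl4 b)
        = ∑ b : F2 n, sign (symp x b) • weyl4 b := by
      intro a
      rw [← Equiv.sum_comp (Equiv.addLeft a) fun b => sign (symp x b) • weyl4 b]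
      refine Finset.sum_congr rfl fun b _ => ?_
      simp only [Equiv.coe_addLeft, symp_add_right, sign_add, Matrix.smul_mul, Matrix.mul_smul,
        weyl4_mul, smul_smul, mul_comm]
    have h1 : Fintype.card (F2 n) = 4 ^ n := by
      simp [F2, ZMod.card, ← mul_pow]
    rw [Finset.sum_congr rfl fun a _ => this a, Finset.sum_const, Finset.card_univ, h1,
      ← Nat.cast_smul_eq_nsmul ℂ]
    simp
  rw [bellEffect, Matrix.smul_mul, Matrix.mul_smul, h, smul_smul, smul_smul]
  congr 1
  field_simp

/-- The four-copy projective measurement `{Π_x}` that performs Bell difference sampling. -/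
def bellMeasurement (n : ℕ) : Measurement (Fin 4 → Qubits n) (F2 n) where
  effect := bellEffect
  posSemidef x := by
    rw [← bellEffect_mul_self]
    nth_rewrite 1 [← bellEffect_conjTranspose]
    exact Matrix.posSemidef_conjTranspose_mul_self _
  sum_eq_one := by
    simp only [bellEffect]
    rw [← Finset.smul_sum, Finset.sum_comm]
    simp only [← Finset.sum_smul, sum_sign_symp, ite_smul, zero_smul, Finset.sum_ite_eq',
      Finset.mem_univ, if_true, weyl4_zero, smul_smul]
    simp

/-- Bell difference sampling: the distribution `q_ρ(x) = tr (Π_x ρ ^ ⊗ 4)` on `𝔽₂²ⁿ`. -/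
def bellDifferenceSampling {n : ℕ} (ρ : Density (Qubits n)) : PMF (F2 n) :=
  (bellMeasurement n).outcome (ρ.copies 4)

/-! ### Stabilizer product states and stabilizer product groups -/

/-- The three single-qubit non-identity Pauli operators. -/
inductive Axis
  | X
  | Y
  | Z
  deriving DecidableEq

instance : Fintype Axis where
  elems := {Axis.X, Axis.Y, Axis.Z}
  complete x := by cases x <;> simp

/-- The label in `𝔽₂²` of a non-identity Pauli operator. -/
def Axis.label : Axis → ZMod 2 × ZMod 2
  | .X => (1, 0)
  | .Y => (1, 1)
  | .Z => (0, 1)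

/-- The six single-qubit stabilizer states. `ket P false` and `ket P true` are the eigenvectors of
`P` with eigenvalue `+1` and `-1`, that is `|+⟩, |-⟩` for `X`, `|i⟩, |-i⟩` for `Y` and
`|0⟩, |1⟩` for `Z`. -/
def ket : Axis → Bool → Fin 2 → ℂ
  | .X, false => ![1 / (√2 : ℝ), 1 / (√2 : ℝ)]
  | .X, true => ![1 / (√2 : ℝ), -1 / (√2 : ℝ)]
  | .Y, false => ![1 / (√2 : ℝ), Complex.I / (√2 : ℝ)]
  | .Y, true => ![1 / (√2 : ℝ), -Complex.I / (√2 : ℝ)]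
  | .Z, false => ![1, 0]
  | .Z, true => ![0, 1]

/-- The set `𝒮𝒫 = {|0⟩, |1⟩, |+⟩, |-⟩, |i⟩, |-i⟩} ^ ⊗ n` of stabilizer product states, each
described by its `n` tensor factors. -/
abbrev SP (n : ℕ) : Type := Fin n → Axis × Bool

/-- The state vector of a stabilizer product state. -/
def SP.vec {n : ℕ} (φ : SP n) : Qubits n → ℂ := tensorVec fun i => ket (φ i).1 (φ i).2

/-- The fidelity `⟨φ|ρ|φ⟩`. -/
def fidelity {n : ℕ} (ρ : Density (Qubits n)) (φ : SP n) : ℝ :=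
  (star φ.vec ⬝ᵥ ρ.mat *ᵥ φ.vec).re

/-- The stabilizer product fidelity `max_{φ ∈ 𝒮𝒫} ⟨φ|ρ|φ⟩`. -/
def maxFidelity {n : ℕ} (ρ : Density (Qubits n)) : ℝ :=
  Finset.univ.sup' ⟨fun _ => (Axis.Z, false), Finset.mem_univ _⟩ (fidelity ρ)

/-- The stabilizer product group `{I, P₁} ⊗ ⋯ ⊗ {I, Pₙ}`. -/
def productGroup {n : ℕ} (P : Fin n → Axis) : Finset (F2 n) :=
  {x | ∀ i, x.at i = 0 ∨ x.at i = (P i).label}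

/-- The state with signs `s` in the basis of stabilizer product states belonging to the stabilizer
product group `{I, P₁} ⊗ ⋯ ⊗ {I, Pₙ}`. -/
def basisState {n : ℕ} (P : Fin n → Axis) (s : Fin n → Bool) : SP n := fun i => (P i, s i)

theorem sum_ket_mul_star (P : Axis) (u v : Fin 2) :
    ∑ b : Bool, ket P b u * star (ket P b v) = if u = v then 1 else 0 := by
  have h : ((√2 : ℝ) : ℂ)⁻¹ * ((√2 : ℝ) : ℂ)⁻¹ = 1 / 2 := by
    rw [← mul_inv, ← Complex.ofReal_mul, Real.mul_self_sqrt (by norm_num)]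
    norm_num
  cases P <;> fin_cases u <;> fin_cases v <;>
    simp [ket, div_eq_mul_inv, mul_mul_mul_comm, h] <;> norm_num

/-- The measurement of `n` qubits in the basis of stabilizer product states that belongs to the
stabilizer product group `{I, P₁} ⊗ ⋯ ⊗ {I, Pₙ}`: the effects are the projectors `|φ⟩⟨φ|`. -/
def basisMeasurement {n : ℕ} (P : Fin n → Axis) : Measurement (Qubits n) (Fin n → Bool) where
  effect s := Matrix.vecMulVec (basisState P s).vec (star (basisState P s).vec)
  posSemidef s := Matrix.posSemidef_vecMulVec_self_star _
  sum_eq_one := by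
    ext u v
    simp only [Matrix.sum_apply, Matrix.vecMulVec_apply, SP.vec, tensorVec, basisState,
      Pi.star_apply, star_prod, ← Finset.prod_mul_distrib]
    rw [← Fintype.prod_sum fun i b => ket (P i) b (u i) * star (ket (P i) b (v i))]
    simp only [sum_ket_mul_star, Matrix.one_apply, Finset.prod_ite_zero, Finset.prod_const_one,
      Finset.mem_univ, true_implies, funext_iff]

/-! ### Local commutation and local span -/

open Classical in
/-- The number `[[x, y]]` of qubits on which the Pauli operators `W_x` and `W_y` do not commute. -/
def localNoncommuting {n : ℕ} (x y : F2 n) : ℕ :=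
  (Finset.univ.filter fun i : Fin n =>
    pauli (x.at i) * pauli (y.at i) ≠ pauli (y.at i) * pauli (x.at i)).card

/-- The local span `{I, W₁} ⊗ ⋯ ⊗ {I, Wₙ}` of a set `V` of pairwise locally commuting Pauli
operators: `Wᵢ` is the only non-identity operator that occurs at qubit `i` in `V`, and `I` if there
is none. -/
def localSpan {n : ℕ} (V : Finset (F2 n)) : Finset (F2 n) :=
  {x | ∀ i, x.at i = 0 ∨ ∃ v ∈ V, x.at i = v.at i}

/-! ### The algorithm -/

/-- The binary entropy (base 2) of a Bernoulli variable. -/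
def entropy (p : ℝ) : ℝ := -p * Real.logb 2 p - (1 - p) * Real.logb 2 (1 - p)

/-- The number of iterations of the outer loop, `log_{3/4} (δ / 2)`. -/
def mOuter (δ : ℝ) : ℕ := ⌈Real.logb (3 / 4) (δ / 2)⌉₊

/-- The clique size, `log_p (1 / (2 n))`. -/
def cliqueSize (n : ℕ) (p : ℝ) : ℕ := ⌈Real.logb p (1 / (2 * n))⌉₊

/-- The number of Bell difference samples in an iteration of the outer loop, `(k + 1) / τ ^ 4`. -/
def mClique (n : ℕ) (p τ : ℝ) : ℕ := ⌈1 / τ ^ 4 * (cliqueSize n p + 1 : ℝ)⌉₊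

/-- The bound `4 log₂ (1 / τ) / (1 - H(p))` on the number of unassigned qubits. -/
def tBound (p τ : ℝ) : ℝ := 4 * Real.logb 2 (1 / τ) / (1 - entropy p)

/-- The number of copies that are measured in each stabilizer product basis,
`8 log (4 m_outer (m_clique choose k) 3 ^ t / δ) / ε ^ 2`. -/
def mEst (n : ℕ) (ε τ p δ : ℝ) : ℕ :=
  ⌈8 * Real.log (4 * (mOuter δ : ℝ) * ((mClique n p τ).choose (cliqueSize n p) : ℝ)
    * (3 : ℝ) ^ tBound p τ / δ) / ε ^ 2⌉₊

/-- Run the randomized procedure `μ` independently `m` times. -/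
def iid {α : Type} (μ : PMF α) : (m : ℕ) → PMF (Fin m → α)
  | 0 => pure Fin.elim0
  | m + 1 => do
      let a ← μ
      let v ← iid μ m
      pure (Fin.cons a v)

/-- Run a randomized procedure on each element of a list, with independent randomness, and collect
the results. -/
def forEach {α β : Type} (f : α → PMF β) : List α → PMF (List β)
  | [] => pure []
  | a :: l => do
      let b ← f a
      let bs ← forEach f l
      pure (b :: bs)

/-- The graph on the Bell difference samples (one vertex for each sample), in which two samples are
adjacent if they locally commute. -/
def commutationGraph {n m : ℕ} (W : Fin m → F2 n) : SimpleGraph (Fin m) :=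
  SimpleGraph.fromRel fun i j => localNoncommuting (W i) (W j) = 0

open Classical in
/-- The stabilizer product groups visited for the samples `W`, with repetitions: for each clique of
size `k` with local span `S` such that `log₂ |S| ≥ n - t`, all the stabilizer product groups that
extend `S`. -/
def visited {n m : ℕ} (k : ℕ) (t : ℝ) (W : Fin m → F2 n) : List (Fin n → Axis) :=
  (((commutationGraph W).cliqueFinset k).toList.filter fun C =>
      (n : ℝ) - t ≤ Real.logb 2 ((localSpan (C.image W)).card : ℝ)).flatMap fun C =>
    (Finset.univ.filter fun P : Fin n → Axis => localSpan (C.image W) ⊆ productGroup P).toList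

/-- Measure `m` copies of `ρ` in the basis of the stabilizer product group given by `P`, and list
the states `φ` of this basis with the empirical probabilities with which they were measured. -/
def estimate {n : ℕ} (m : ℕ) (ρ : Density (Qubits n)) (P : Fin n → Axis) :
    PMF (List (SP n × ℝ)) := do
  let v ← iid ((basisMeasurement P).outcome ρ) m
  pure (Finset.univ.toList.map fun s : Fin n → Bool =>
    (basisState P s, ((Finset.univ.filter fun j : Fin m => v j = s).card : ℝ) / m))

/-- One iteration of the outer loop: it returns all the pairs of a state `φ` and an estimate of its
fidelity that are computed in this iteration. -/
def outerIteration {n : ℕ} (ε τ p δ : ℝ) (ρ : Density (Qubits n)) : PMF (List (SP n × ℝ)) := do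
  let W ← iid (bellDifferenceSampling ρ) (mClique n p τ)
  let estimates ← forEach (estimate (mEst n ε τ p δ) ρ) (visited (cliqueSize n p) (tBound p τ) W)
  pure estimates.flatten

/-- A rule that picks a state with the largest estimate from a list of states with estimates; how
ties are broken, and what is returned for the empty list, is left open. -/
structure SelectionRule (n : ℕ) where
  pick : List (SP n × ℝ) → SP n
  pick_isMax : ∀ l, l ≠ [] → ∃ e ∈ l, pick l = e.1 ∧ ∀ e' ∈ l, e'.2 ≤ e.2

/-- The distribution of the output of the algorithm, run on copies of `ρ`. -/
def algorithm {n : ℕ} (ε τ p δ : ℝ) (R : SelectionRule n) (ρ : Density (Qubits n)) :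
    PMF (SP n) := do
  let runs ← iid (outerIteration ε τ p δ ρ) (mOuter δ)
  pure (R.pick (List.ofFn runs).flatten)

end StabProd

end

/-! Let φ attain the maximal fidelity, which is at least τ, and let P be its axes. If some iteration
visits the basis of P and every recorded estimate is within ε/2 of the truth, the final choice is
ε-optimal.

Visiting P. The projector onto φ is an average of signed elements of the group of P, so the power
mean inequality gives τ⁴ ≤ Q, where Q is the Bell difference weight of the group
(`fidelity_pow_four_le`). Since tr ρ² ≤ 1, no Bell difference probability exceeds 2⁻ⁿ
(`bellDifferenceSampling_le`). Conditioned on the group, a sample thus has entropy at least n -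
log₂(1/Q), while a qubit at which it is the identity with conditional probability above p costs at
least 1 - H(p) bits; so there are at most t such qubits (`card_mul_one_sub_entropy_le`). With
probability at least 1/2 at least k samples fall in the group, because their mean number is at least
k (`half_le_binomTail`), and k of them miss one of the remaining qubits with probability at most n
pᵏ ≤ 1/2 (`le_expect_exists_cover`). Otherwise they form a clique with a large local span inside the
group, and P is visited (`mem_visited_of_mem_coverEvent`). An iteration thus misses P with
probability at most 3/4, and all of them do with probability at most δ/2.

Accuracy. An iteration visits at most (m_clique choose k) 3ᵗ bases (`length_visited_le`). In each,
all 2ⁿ frequencies are controlled at once: the expected largest deviation of a count is at most √m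
whatever n is, and McDiarmid's inequality concentrates it (`expect_exists_deviation_le`). A union
bound over bases and iterations costs δ/4. -/

namespace StabProd

/-! ### Expectations over independent samples -/

section Expect

variable {α : Type} [Fintype α]

theorem sum_toReal (μ : PMF α) : ∑ a, (μ a).toReal = 1 := by
  rw [← ENNReal.toReal_sum fun a _ => μ.apply_ne_top a, ← tsum_fintype (L := .unconditional _),
    μ.tsum_coe, ENNReal.toReal_one]

/-- The expectation of `g` over `m` independent samples from `μ`. -/
noncomputable def expect (μ : PMF α) (m : ℕ) (g : (Fin m → α) → ℝ) : ℝ :=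
  ∑ v, (∏ j, (μ (v j)).toReal) * g v

theorem expect_zero (μ : PMF α) (g : (Fin 0 → α) → ℝ) : expect μ 0 g = g Fin.elim0 := by
  simp [expect, Subsingleton.elim (default : Fin 0 → α) Fin.elim0]

theorem expect_succ (μ : PMF α) (m : ℕ) (g : (Fin (m + 1) → α) → ℝ) :
    expect μ (m + 1) g = ∑ a, (μ a).toReal * expect μ m fun v => g (Fin.cons a v) := by
  simp only [expect, Finset.mul_sum]
  rw [← Equiv.sum_comp (Fin.consEquiv fun _ => α), Fintype.sum_prod_type]
  simp [Fin.consEquiv, Fin.prod_univ_succ, mul_assoc]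

theorem expect_mono (μ : PMF α) (m : ℕ) {f g : (Fin m → α) → ℝ} (h : ∀ v, f v ≤ g v) :
    expect μ m f ≤ expect μ m g :=
  Finset.sum_le_sum fun v _ => mul_le_mul_of_nonneg_left (h v) (by positivity)

theorem expect_const (μ : PMF α) (m : ℕ) (c : ℝ) : expect μ m (fun _ => c) = c := by
  induction m with
  | zero => simp [expect_zero]
  | succ m ih => simp [expect_succ, ih, ← Finset.sum_mul, sum_toReal]

theorem expect_add (μ : PMF α) (m : ℕ) (f g : (Fin m → α) → ℝ) :
    expect μ m (fun v => f v + g v) = expect μ m f + expect μ m g := by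
  simp [expect, mul_add, Finset.sum_add_distrib]

theorem expect_const_mul (μ : PMF α) (m : ℕ) (c : ℝ) (f : (Fin m → α) → ℝ) :
    expect μ m (fun v => c * f v) = c * expect μ m f := by
  simp only [expect, Finset.mul_sum]
  exact Finset.sum_congr rfl fun v _ => by ring

theorem expect_sum {ι : Type} (μ : PMF α) (m : ℕ) (s : Finset ι) (f : ι → (Fin m → α) → ℝ) :
    expect μ m (fun v => ∑ i ∈ s, f i v) = ∑ i ∈ s, expect μ m (f i) := by
  simp only [expect, Finset.mul_sum]
  exact Finset.sum_comm

theorem abs_expect_sub_le (μ : PMF α) (m : ℕ) {c : ℝ} {f g : (Fin m → α) → ℝ}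
    (h : ∀ v, |f v - g v| ≤ c) : |expect μ m f - expect μ m g| ≤ c := by
  have h1 : expect μ m f ≤ expect μ m g + c := by
    rw [← expect_const μ m c, ← expect_add]
    exact expect_mono μ m fun v => by linarith [(abs_le.mp (h v)).2]
  have h2 : expect μ m g ≤ expect μ m f + c := by
    rw [← expect_const μ m c, ← expect_add]
    exact expect_mono μ m fun v => by linarith [(abs_le.mp (h v)).1]
  exact abs_le.mpr ⟨by linarith, by linarith⟩

theorem sq_expect_le (μ : PMF α) (m : ℕ) (f : (Fin m → α) → ℝ) :
    expect μ m f ^ 2 ≤ expect μ m fun v => f v ^ 2 := by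
  set e := expect μ m f
  have h : 0 ≤ expect μ m fun v => (f v ^ 2 + (-2 * e) * f v) + e ^ 2 := by
    rw [← expect_const μ m 0]
    exact expect_mono μ m fun v => by nlinarith [sq_nonneg (f v - e)]
  rw [expect_add, expect_add, expect_const_mul, expect_const] at h
  have : expect μ m f = e := rfl
  rw [this] at h
  nlinarith

/-- The bridge from the monadic sampler to finite real sums: concentration is proved for `expect`,
whereas the algorithm is a `PMF`. It rests on the product formula for the point masses of `iid`. -/
theorem toOuterMeasure_iid (μ : PMF α) (m : ℕ) (s : Set (Fin m → α)) :
    (iid μ m).toOuterMeasure s = ENNReal.ofReal (expect μ m (s.indicator 1)) := by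
  have hiid : ∀ m (v : Fin m → α), iid μ m v = ∏ j, μ (v j) := by
    intro m
    induction m with
    | zero =>
      intro v
      have : v = Fin.elim0 := Subsingleton.elim _ _
      subst this
      change (PMF.pure Fin.elim0 : PMF (Fin 0 → α)) Fin.elim0 = _
      simp
    | succ m ih =>
      intro v
      change (μ.bind fun a => (iid μ m).bind fun w => PMF.pure (Fin.cons a w)) v = _
      classical
      simp only [PMF.bind_apply, PMF.pure_apply, tsum_fintype]
      obtain ⟨⟨a, w⟩, rfl⟩ := (Fin.consEquiv fun _ => α).surjective v
      have hc : ∀ (b : α) (u : Fin m → α),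
          (Fin.cons a w : Fin (m + 1) → α) = Fin.cons b u ↔ a = b ∧ w = u := by
        intro b u
        exact Fin.cons_inj
      simp only [Fin.consEquiv, Equiv.coe_fn_mk, hc, Fin.prod_univ_succ, Fin.cons_zero,
        Fin.cons_succ]
      rw [Finset.sum_eq_single a, Finset.sum_eq_single w] <;> simp +contextual [ih, eq_comm]
  classical
  rw [PMF.toOuterMeasure_apply_fintype, expect, ENNReal.ofReal_sum_of_nonneg]
  · refine Finset.sum_congr rfl fun v _ => ?_
    by_cases hv : v ∈ s
    · simp only [Set.indicator_of_mem hv, hiid, Pi.one_apply, mul_one]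
      rw [← ENNReal.toReal_prod, ENNReal.ofReal_toReal]
      exact ENNReal.prod_ne_top fun j _ => μ.apply_ne_top _
    · simp [hv]
  · intro v _
    by_cases hv : v ∈ s <;> simp [hv, Finset.prod_nonneg]

/-- Hoeffding's lemma. -/
theorem sum_exp_le (μ : PMF α) (g : α → ℝ) {c : ℝ} (hc : ∀ a b, g a - g b ≤ c) (t : ℝ) :
    ∑ a, (μ a).toReal * Real.exp (t * (g a - ∑ b, (μ b).toReal * g b)) ≤
      Real.exp (c ^ 2 * t ^ 2 / 8) := by
  let _ : MeasurableSpace α := ⊤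
  have : MeasurableSingletonClass α := ⟨fun _ => trivial⟩
  obtain ⟨a₀, -⟩ := μ.support_nonempty
  have : Nonempty α := ⟨a₀⟩
  -- The oscillation bound confines g to the interval from its minimum to its minimum plus c.
  obtain ⟨a, ha⟩ := Finite.exists_min g
  have h := ProbabilityTheory.hasSubgaussianMGF_of_mem_Icc (μ := μ.toMeasure) (X := g)
    (a := g a) (b := g a + c) (measurable_of_finite g).aemeasurable
    (Filter.Eventually.of_forall fun b => ⟨ha b, by linarith [hc b a]⟩)
  have := h.mgf_le t
  simp only [ProbabilityTheory.mgf, PMF.integral_eq_sum, smul_eq_mul] at this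
  refine this.trans (le_of_eq ?_)
  congr 1
  simp only [add_sub_cancel_left, NNReal.coe_pow, NNReal.coe_div, coe_nnnorm, Real.norm_eq_abs,
    NNReal.coe_ofNat, div_pow, sq_abs]
  ring

/-- McDiarmid's inequality for the moment generating function. -/
theorem expect_exp_le (μ : PMF α) {c : ℝ} (t : ℝ) (m : ℕ) (F : (Fin m → α) → ℝ)
    (hF : ∀ i v w, (∀ j, j ≠ i → v j = w j) → |F v - F w| ≤ c) :
    expect μ m (fun v => Real.exp (t * (F v - expect μ m F))) ≤
      Real.exp (m * (c ^ 2 * t ^ 2 / 8)) := by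
  induction m with
  | zero => simp [expect_zero]
  | succ m ih =>
    -- The mean of F given the first sample. F - E F splits into F - g a, covered by induction for
    -- each fixed a, and g a - E g, covered by Hoeffding's lemma because g also oscillates by at
    -- most c.
    set g : α → ℝ := fun a => expect μ m fun v => F (Fin.cons a v) with hg
    have hE : expect μ (m + 1) F = ∑ a, (μ a).toReal * g a := expect_succ μ m F
    have hgc : ∀ a b, g a - g b ≤ c := fun a b =>
      (le_abs_self _).trans <| abs_expect_sub_le μ m fun v => hF 0 _ _ fun j hj => by
        obtain ⟨k, rfl⟩ := Fin.exists_succ_eq.mpr hj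
        simp
    rw [expect_succ]
    calc ∑ a, (μ a).toReal * expect μ m (fun v =>
            Real.exp (t * (F (Fin.cons a v) - expect μ (m + 1) F)))
        = ∑ a, (μ a).toReal * (Real.exp (t * (g a - ∑ b, (μ b).toReal * g b)) *
            expect μ m (fun v => Real.exp (t * (F (Fin.cons a v) - g a)))) := by
          refine Finset.sum_congr rfl fun a _ => congrArg _ ?_
          rw [hE, ← expect_const_mul]
          refine congrArg _ (funext fun v => ?_)
          rw [← Real.exp_add]
          congr 1
          ring
      _ ≤ ∑ a, (μ a).toReal * (Real.exp (t * (g a - ∑ b, (μ b).toReal * g b)) *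
            Real.exp (m * (c ^ 2 * t ^ 2 / 8))) := by
          refine Finset.sum_le_sum fun a _ => mul_le_mul_of_nonneg_left
            (mul_le_mul_of_nonneg_left (ih _ fun i v w h => hF i.succ _ _ fun j hj => ?_)
              (Real.exp_pos _).le) ENNReal.toReal_nonneg
          refine Fin.cases (by simp) (fun k hk => ?_) j hj
          simpa using h k fun e => hk (by rw [e])
      _ = (∑ a, (μ a).toReal * Real.exp (t * (g a - ∑ b, (μ b).toReal * g b))) *
            Real.exp (m * (c ^ 2 * t ^ 2 / 8)) := by
          rw [Finset.sum_mul]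
          exact Finset.sum_congr rfl fun a _ => by ring
      _ ≤ Real.exp (c ^ 2 * t ^ 2 / 8) * Real.exp (m * (c ^ 2 * t ^ 2 / 8)) :=
          mul_le_mul_of_nonneg_right (sum_exp_le μ g hgc t) (Real.exp_pos _).le
      _ = _ := by
          rw [← Real.exp_add]
          congr 1
          push_cast
          ring

end Expect

/-! ### The upper tail of the binomial distribution -/

/-- The probability that at least `k` of `m` independent trials with success probability `q`
succeed. -/
def binomTail : ℕ → ℕ → ℝ → ℝ
  | _, 0, _ => 1
  | 0, _ + 1, _ => 0
  | m + 1, k + 1, q => (1 - q) * binomTail m (k + 1) q + q * binomTail m k q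

theorem binomTail_zero (m : ℕ) (q : ℝ) : binomTail m 0 q = 1 := by
  cases m <;> rfl

theorem binomTail_nonneg {q : ℝ} (h0 : 0 ≤ q) (h1 : q ≤ 1) :
    ∀ m k : ℕ, 0 ≤ binomTail m k q
  | m, 0 => by simp [binomTail_zero]
  | 0, k + 1 => le_rfl
  | m + 1, k + 1 => add_nonneg
      (mul_nonneg (by linarith) (binomTail_nonneg h0 h1 m (k + 1)))
      (mul_nonneg h0 (binomTail_nonneg h0 h1 m k))

theorem binomTail_one : ∀ {m k : ℕ}, k ≤ m → binomTail m k 1 = 1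
  | m, 0, _ => binomTail_zero m 1
  | m + 1, k + 1, h => by
    simp [binomTail, binomTail_one (Nat.le_of_succ_le_succ h)]

/-- The difference of consecutive tails is a point mass. For k > m the truncated exponent is
harmless, as the binomial coefficient vanishes. -/
theorem binomTail_sub (q : ℝ) : ∀ m k : ℕ,
    binomTail m k q - binomTail m (k + 1) q = m.choose k * q ^ k * (1 - q) ^ (m - k)
  | 0, 0 => by simp [binomTail]
  | 0, k + 1 => by simp [binomTail]
  | m + 1, 0 => by
    have := binomTail_sub q m 0
    simp only [binomTail, binomTail_zero, Nat.choose_zero_right, Nat.sub_zero, pow_succ] at this ⊢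
    linear_combination (1 - q) * this
  | m + 1, k + 1 => by
    have h1 := binomTail_sub q m k
    have h2 := binomTail_sub q m (k + 1)
    rcases lt_or_ge k m with h | h
    · obtain ⟨d, rfl⟩ := Nat.exists_eq_add_of_lt h
      rw [show k + d + 1 - k = d + 1 by omega] at h1
      rw [show k + d + 1 - (k + 1) = d by omega] at h2
      rw [show k + d + 1 + 1 - (k + 1) = d + 1 by omega, Nat.choose_succ_succ]
      simp only [binomTail, pow_succ] at h1 h2 ⊢
      push_cast
      linear_combination q * h1 + (1 - q) * h2
    · have h3 : m.choose (k + 1) = 0 := Nat.choose_eq_zero_of_lt (by omega)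
      rw [h3] at h2
      rw [show m - k = 0 by omega] at h1
      rw [show m + 1 - (k + 1) = 0 by omega, Nat.choose_succ_succ, h3]
      simp only [binomTail, pow_succ, pow_zero] at h1 h2 ⊢
      push_cast at h2 ⊢
      linear_combination q * h1 + (1 - q) * h2

/-- Differentiating the recursion yields a difference of two tails, hence a point mass, plus a
mixture of earlier derivatives; these add up to a beta density. -/
theorem hasDerivAt_binomTail (q : ℝ) : ∀ m k : ℕ,
    HasDerivAt (binomTail (m + 1) (k + 1))
      ((m + 1) * (m.choose k * q ^ k * (1 - q) ^ (m - k))) q := by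
  have hstep : ∀ (m k : ℕ) {a b : ℝ}, HasDerivAt (binomTail m (k + 1)) a q →
      HasDerivAt (binomTail m k) b q → HasDerivAt (binomTail (m + 1) (k + 1))
        (m.choose k * q ^ k * (1 - q) ^ (m - k) + (1 - q) * a + q * b) q := by
    intro m k a b ha hb
    rw [← binomTail_sub]
    refine ((((hasDerivAt_id q).const_sub 1).mul ha).add
      ((hasDerivAt_id q).mul hb)).congr_deriv ?_
    simp
    ring
  have hzero : ∀ m : ℕ, HasDerivAt (binomTail m 0) 0 q := by
    intro m
    have : binomTail m 0 = fun _ => (1 : ℝ) := funext fun q => binomTail_zero m q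
    rw [this]
    exact hasDerivAt_const q 1
  have hz : ∀ k : ℕ, HasDerivAt (binomTail 0 (k + 1)) 0 q := fun k => hasDerivAt_const q 0
  intro m
  induction m with
  | zero =>
    intro k
    refine (hstep 0 k (b := 0) (hz k) ?_).congr_deriv ?_
    · cases k
      · exact hzero 0
      · exact hz _
    · simp
  | succ m ih =>
    intro k
    cases k with
    | zero =>
      refine (hstep (m + 1) 0 (ih 0) (hzero _)).congr_deriv ?_
      simp only [Nat.choose_zero_right, Nat.sub_zero, pow_succ]
      push_cast
      ring
    | succ k =>
      refine (hstep (m + 1) (k + 1) (ih (k + 1)) (ih k)).congr_deriv ?_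
      rcases lt_or_ge k m with h | h
      · obtain ⟨d, rfl⟩ := Nat.exists_eq_add_of_lt h
        rw [show k + d + 1 - k = d + 1 by omega, show k + d + 1 - (k + 1) = d by omega,
          show k + d + 1 + 1 - (k + 1) = d + 1 by omega, Nat.choose_succ_succ]
        push_cast
        ring
      · rw [show m - k = 0 by omega, show m + 1 - (k + 1) = 0 by omega, Nat.choose_succ_succ,
          Nat.choose_eq_zero_of_lt (show m < k + 1 by omega)]
        push_cast
        ring

/-- Comparison of the binomial density at `q y` and `q / y`. -/
theorem pow_mul_one_sub_pow_le {q y : ℝ} {k N : ℕ} (hq : 0 < q) (hk : k * (1 - q) ≤ N * q)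
    (hy : 1 ≤ y) (hqy : q * y < 1) :
    y ^ (2 * k) * (1 - q * y) ^ N ≤ (1 - q / y) ^ N := by
  have key : ∀ z, 1 ≤ z → q * z < 1 →
      0 ≤ N * Real.log (1 - q / z) - N * Real.log (1 - q * z) - 2 * k * Real.log z := by
    intro z hz hqz
    -- The logarithm of the right side over the left side. It vanishes at 1, so monotonicity is
    -- enough.
    set G : ℝ → ℝ := fun z =>
      N * Real.log (1 - q / z) - N * Real.log (1 - q * z) - 2 * k * Real.log z with hG
    have hpos : ∀ x ∈ Set.Icc 1 z, 0 < x - q ∧ 0 < 1 - q * x := by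
      intro x hx
      have h1 : q * x ≤ q * z := mul_le_mul_of_nonneg_left hx.2 hq.le
      have h2 : q * 1 ≤ q * x := mul_le_mul_of_nonneg_left hx.1 hq.le
      exact ⟨by linarith [hx.1], by linarith⟩
    have hder : ∀ x ∈ Set.Icc 1 z, HasDerivAt G
        (N * (q / x ^ 2 / (1 - q / x)) - N * (-q / (1 - q * x)) - 2 * k * (1 / x)) x := by
      intro x hx
      obtain ⟨h1, h2⟩ := hpos x hx
      have hx0 : 0 < x := by linarith [hx.1]
      have h3 : 1 - q / x ≠ 0 := by
        rw [one_sub_div hx0.ne']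
        positivity
      have d1 : HasDerivAt (fun x => 1 - q / x) (q / x ^ 2) x := by
        refine (((hasDerivAt_inv hx0.ne').const_mul q).const_sub 1).congr_deriv ?_
        field_simp
      have d2 : HasDerivAt (fun x => 1 - q * x) (-q) x := by
        refine (((hasDerivAt_id x).const_mul q).const_sub 1).congr_deriv ?_
        simp
      refine (((d1.log h3).const_mul (N : ℝ)).sub ((d2.log h2.ne').const_mul (N : ℝ))).sub
        (((hasDerivAt_id x).log hx0.ne').const_mul (2 * k : ℝ))
    have hmono : MonotoneOn G (Set.Icc 1 z) := by
      refine monotoneOn_of_deriv_nonneg (convex_Icc 1 z)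
        (fun x hx => (hder x hx).continuousAt.continuousWithinAt)
        (fun x hx => (hder x (interior_subset hx)).differentiableAt.differentiableWithinAt)
        fun x hx => ?_
      have hx := interior_subset hx
      rw [(hder x hx).deriv]
      obtain ⟨h1, h2⟩ := hpos x hx
      have hx0 : 0 < x := by linarith [hx.1]
      have h3 : 0 < 1 - q := by nlinarith [hx.1]
      -- This form shows the sign: the first summand contains a square, and the second is
      -- nonnegative exactly by the hypothesis `hk`.
      have e : N * (q / x ^ 2 / (1 - q / x)) - N * (-q / (1 - q * x)) - 2 * k * (1 / x)
          = (N * (q * ((1 + q) * (x - 1) ^ 2) / ((x - q) * (1 - q * x) * (1 - q)))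
            + 2 * (N * q - k * (1 - q)) / (1 - q)) / x := by
        rw [one_sub_div hx0.ne']
        field_simp
        ring
      rw [e]
      have h4 : 0 ≤ N * q - k * (1 - q) := by linarith
      positivity
    have := hmono (Set.left_mem_Icc.mpr hz) (Set.right_mem_Icc.mpr hz) hz
    simpa [hG] using this
  have hy0 : 0 < y := by linarith
  have hqy' : q / y < 1 := by
    rw [div_lt_one hy0]
    nlinarith
  have := key y hy hqy
  rw [← Real.log_le_log_iff (by have : 0 < 1 - q * y := by linarith
                                positivity)
      (by have : 0 < 1 - q / y := by linarith
          positivity), Real.log_mul (by positivity) (pow_ne_zero _ (by linarith)), Real.log_pow,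
    Real.log_pow, Real.log_pow]
  push_cast
  linarith

/-- The median of a binomial distribution is at least the integer part of its mean. -/
theorem half_le_binomTail {q : ℝ} {m k : ℕ} (hq : 0 ≤ q) (hq1 : q ≤ 1) (h : (k : ℝ) ≤ m * q) :
    1 / 2 ≤ binomTail m k q := by
  rcases k.eq_zero_or_pos with rfl | hk
  · norm_num [binomTail_zero]
  rcases hq1.eq_or_lt with rfl | hq1
  · rw [binomTail_one (by simpa using h)]
    norm_num
  have hk' : (0 : ℝ) < k := by exact_mod_cast hk
  have hq0 : 0 < q := hq.lt_of_ne fun e => by simp [← e] at h; omega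
  have hkm : k ≤ m := by
    have : (k : ℝ) ≤ m := h.trans (by nlinarith [(Nat.cast_nonneg m : (0 : ℝ) ≤ m)])
    exact_mod_cast this
  obtain ⟨k, rfl⟩ := Nat.exists_eq_add_of_lt hk
  obtain ⟨d, rfl⟩ := Nat.exists_eq_add_of_le hkm
  simp only [zero_add] at *
  rw [show k + 1 + d = k + d + 1 by omega] at h ⊢
  set f : ℝ → ℝ := binomTail (k + d + 1) (k + 1)
  have hf : ∀ x, HasDerivAt f (((k + d : ℕ) + 1) * ((k + d).choose k * x ^ k * (1 - x) ^ d)) x := by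
    intro x
    simpa using hasDerivAt_binomTail x (k + d) k
  have hder : ∀ y ∈ Set.Icc 1 (1 / q), HasDerivAt (fun y => f (q * y) + f (q / y))
      (((k + d : ℕ) + 1) * ((k + d).choose k * (q * y) ^ k * (1 - q * y) ^ d) * q +
        ((k + d : ℕ) + 1) * ((k + d).choose k * (q / y) ^ k * (1 - q / y) ^ d) * -(q / y ^ 2))
      y := by
    intro y hy
    have hy0 : 0 < y := by linarith [hy.1]
    refine ((hf (q * y)).comp y (((hasDerivAt_id y).const_mul q).congr_deriv (by simp))).add
      ((hf (q / y)).comp y (((hasDerivAt_inv hy0.ne').const_mul q).congr_deriv ?_))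
    field_simp
  -- Comparing the ends of the interval: the value at 1 is 2 f(q), and at 1/q it is f(1) + f(q²) ≥
  -- 1.
  have hanti : AntitoneOn (fun y => f (q * y) + f (q / y)) (Set.Icc 1 (1 / q)) := by
    refine antitoneOn_of_deriv_nonpos (convex_Icc _ _)
      (fun y hy => (hder y hy).continuousAt.continuousWithinAt)
      (fun y hy => (hder y (interior_subset hy)).differentiableAt.differentiableWithinAt)
      fun y hy => ?_
    rw [(hder y (interior_subset hy)).deriv]
    rw [interior_Icc] at hy
    have hy0 : 0 < y := by linarith [hy.1]
    have hqy : q * y < 1 := by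
      have := (lt_div_iff₀ hq0).mp hy.2
      linarith
    -- Here the number of trials is k + 1 + d, so the hypothesis on the mean reads (k + 1)(1 - q) ≤
    -- d q.
    have hle := pow_mul_one_sub_pow_le (k := k + 1) (N := d) hq0 (by push_cast at h ⊢; nlinarith)
      hy.1.le hqy
    have e : ((k + d : ℕ) + 1) * ((k + d).choose k * (q * y) ^ k * (1 - q * y) ^ d) * q +
        ((k + d : ℕ) + 1) * ((k + d).choose k * (q / y) ^ k * (1 - q / y) ^ d) * -(q / y ^ 2) =
        -(((k + d : ℕ) + 1) * (k + d).choose k * q ^ (k + 1) / y ^ (k + 2) *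
          ((1 - q / y) ^ d - y ^ (2 * (k + 1)) * (1 - q * y) ^ d)) := by
      have e2 : (q / y) ^ k = q ^ k / y ^ k := div_pow _ _ _
      generalize (1 - q / y) ^ d = a
      generalize (1 - q * y) ^ d = b
      rw [e2]
      field_simp
      ring
    rw [e]
    have : 0 ≤ (1 - q / y) ^ d - y ^ (2 * (k + 1)) * (1 - q * y) ^ d := by linarith
    have : 0 ≤ ((k + d : ℕ) + 1) * (k + d).choose k * q ^ (k + 1) / y ^ (k + 2) *
          ((1 - q / y) ^ d - y ^ (2 * (k + 1)) * (1 - q * y) ^ d) := by positivity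
    linarith
  have h1q : 1 ≤ 1 / q := by
    rw [le_div_iff₀ hq0]
    linarith
  have := hanti (Set.left_mem_Icc.mpr h1q) (Set.right_mem_Icc.mpr h1q) h1q
  have e1 : q * (1 / q) = 1 := by field_simp
  have e2 : q / (1 / q) = q * q := by field_simp
  have e3 : f 1 = 1 := binomTail_one (by omega)
  have e4 : 0 ≤ f (q * q) := binomTail_nonneg (by positivity) (by nlinarith) _ _
  simp only [e1, e2, e3, mul_one, div_one] at this
  linarith

/-! ### Sampling a covering clique -/

/-- The event that some `k` of the `m` samples lie in `A` and no `i ∈ U` is missed, in the sense of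
`Z`, by all of them. -/
def coverEvent {α ι : Type} (A : Finset α) (Z : ι → α → Prop) (m k : ℕ) (U : Finset ι) :
    Set (Fin m → α) :=
  {v | ∃ C : Finset (Fin m), C.card = k ∧ (∀ j ∈ C, v j ∈ A) ∧ ∀ i ∈ U, ∃ j ∈ C, ¬ Z i (v j)}

-- Induction on the samples. A first sample in A lowers k by one and shrinks U to the indices it
-- misses, on average to at most a p-fraction; a sample outside A changes nothing. Because the bound
-- is linear in the size of U, only this average matters, and independence of the indices is not
-- needed.
open Classical in
theorem le_expect_exists_cover {α ι : Type} [Fintype α] (μ : PMF α) (A : Finset α) (p : ℝ)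
    (hp : 0 ≤ p) (Z : ι → α → Prop) (m : ℕ) : ∀ (k : ℕ) (U : Finset ι),
    (∀ i ∈ U, ∑ x ∈ A with Z i x, (μ x).toReal ≤ p * ∑ x ∈ A, (μ x).toReal) →
    binomTail m k (∑ x ∈ A, (μ x).toReal) * (1 - U.card * p ^ k) ≤
      expect μ m ((coverEvent A Z m k U).indicator 1) := by
  set Q := ∑ x ∈ A, (μ x).toReal with hQ
  have hQ0 : 0 ≤ Q := Finset.sum_nonneg fun _ _ => ENNReal.toReal_nonneg
  have hQ1 : Q ≤ 1 := by
    rw [← sum_toReal μ]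
    exact Finset.sum_le_sum_of_subset_of_nonneg (Finset.subset_univ _)
      fun _ _ _ => ENNReal.toReal_nonneg
  have hind : ∀ {m : ℕ} (s : Set (Fin m → α)), 0 ≤ expect μ m (s.indicator 1) := by
    intro m s
    rw [← expect_const μ m 0]
    exact expect_mono μ m fun v => Set.indicator_nonneg (fun _ _ => zero_le_one) v
  have hmono : ∀ {β γ : Type} {s : Set β} {t : Set γ} {b : β} {c : γ}, (b ∈ s → c ∈ t) →
      s.indicator (1 : β → ℝ) b ≤ t.indicator (1 : γ → ℝ) c := by
    intro β γ s t b c h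
    by_cases hb : b ∈ s
    · simp [hb, h hb]
    · rw [Set.indicator_of_notMem hb]
      exact Set.indicator_nonneg (fun _ _ => zero_le_one) _
  have hbase : ∀ (m : ℕ) (U : Finset ι), binomTail m 0 Q * (1 - U.card * p ^ 0) ≤
      expect μ m ((coverEvent A Z m 0 U).indicator 1) := by
    intro m U
    rcases U.eq_empty_or_nonempty with rfl | hU
    · simp only [binomTail_zero, Finset.card_empty]
      have : coverEvent A Z m 0 (∅ : Finset ι) = Set.univ :=
        Set.eq_univ_of_forall fun v => ⟨∅, by simp⟩
      rw [this, Set.indicator_univ]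
      change _ ≤ expect μ m fun _ => 1
      simp [expect_const]
    -- With k = 0 and U nonempty the claimed lower bound is nonpositive.
    · refine le_trans ?_ (hind _)
      have : (1 : ℝ) ≤ U.card := by exact_mod_cast hU.card_pos
      simp only [binomTail_zero, pow_zero]
      linarith
  induction m with
  | zero =>
    intro k U hU
    cases k with
    | zero => exact hbase 0 U
    | succ k => simpa [binomTail] using hind _
  | succ m ih =>
    intro k U hU
    cases k with
    | zero => exact hbase _ U
    | succ k =>
      rw [expect_succ]
      have h1 : ∀ a, binomTail m (k + 1) Q * (1 - U.card * p ^ (k + 1)) ≤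
          expect μ m fun v =>
            (coverEvent A Z (m + 1) (k + 1) U).indicator 1 (Fin.cons a v : Fin (m + 1) → α) := by
        intro a
        refine (ih (k + 1) U hU).trans (expect_mono μ m fun v => ?_)
        refine hmono fun ⟨C, hC, hA, hcov⟩ => ⟨C.map (Fin.succEmb m), by simp [hC], ?_, ?_⟩
        · simpa using hA
        · intro i hi
          obtain ⟨j, hj, hZ⟩ := hcov i hi
          exact ⟨j.succ, by simpa using hj, by simpa using hZ⟩
      have h2 : ∀ a ∈ A, binomTail m k Q * (1 - (U.filter fun i => Z i a).card * p ^ k) ≤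
          expect μ m fun v =>
            (coverEvent A Z (m + 1) (k + 1) U).indicator 1 (Fin.cons a v : Fin (m + 1) → α) := by
        intro a ha
        refine (ih k (U.filter fun i => Z i a)
          fun i hi => hU i (Finset.mem_filter.mp hi).1).trans (expect_mono μ m fun v => ?_)
        refine hmono fun ⟨C, hC, hA, hcov⟩ =>
          ⟨insert 0 (C.map (Fin.succEmb m)), ?_, ?_, ?_⟩
        · rw [Finset.card_insert_of_notMem (by simp), Finset.card_map, hC]
        · simpa using ⟨ha, hA⟩
        · intro i hi
          by_cases hZa : Z i a
          · obtain ⟨j, hj, hZ⟩ := hcov i (Finset.mem_filter.mpr ⟨hi, hZa⟩)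
            exact ⟨j.succ, by simpa using hj, by simpa using hZ⟩
          · exact ⟨0, by simp, by simpa using hZa⟩
      -- Exchanging the sums turns the expected number of missed indices into the hypothesis for
      -- each index.
      have h3 : ∑ a ∈ A, (μ a).toReal * ((U.filter fun i => Z i a).card : ℝ) ≤ U.card * (p * Q) := by
        have : ∀ a, (μ a).toReal * ((U.filter fun i => Z i a).card : ℝ) =
            ∑ i ∈ U, if Z i a then (μ a).toReal else 0 := by
          intro a
          rw [← Finset.sum_filter, Finset.sum_const, nsmul_eq_mul, mul_comm]
        simp only [this]
        rw [Finset.sum_comm, ← nsmul_eq_mul]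
        refine Finset.sum_le_card_nsmul _ _ _ fun i hi => ?_
        rw [← Finset.sum_filter]
        exact hU i hi
      have h4 : ∑ a ∈ Aᶜ, (μ a).toReal = 1 - Q := by
        have := Finset.sum_add_sum_compl A fun a => (μ a).toReal
        rw [sum_toReal] at this
        linarith
      rw [← Finset.sum_add_sum_compl A]
      calc binomTail (m + 1) (k + 1) Q * (1 - U.card * p ^ (k + 1))
          = binomTail m k Q * (Q - p ^ k * (U.card * (p * Q))) +
            (1 - Q) * (binomTail m (k + 1) Q * (1 - U.card * p ^ (k + 1))) := by
            rw [binomTail]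
            ring
        _ ≤ binomTail m k Q * (Q - p ^ k *
              ∑ a ∈ A, (μ a).toReal * ((U.filter fun i => Z i a).card : ℝ)) +
            (1 - Q) * (binomTail m (k + 1) Q * (1 - U.card * p ^ (k + 1))) := by
            have := binomTail_nonneg hQ0 hQ1 m k
            gcongr
        _ = ∑ a ∈ A, (μ a).toReal *
              (binomTail m k Q * (1 - (U.filter fun i => Z i a).card * p ^ k)) +
            ∑ a ∈ Aᶜ, (μ a).toReal * (binomTail m (k + 1) Q * (1 - U.card * p ^ (k + 1))) := by
            rw [← Finset.sum_mul, h4, hQ, Finset.mul_sum, ← Finset.sum_sub_distrib, Finset.mul_sum]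
            congr 1
            exact Finset.sum_congr rfl fun a _ => by ring
        _ ≤ _ := add_le_add
            (Finset.sum_le_sum fun a ha => mul_le_mul_of_nonneg_left (h2 a ha)
              ENNReal.toReal_nonneg)
            (Finset.sum_le_sum fun a _ => mul_le_mul_of_nonneg_left (h1 a)
              ENNReal.toReal_nonneg)

/-! ### Uniform concentration of empirical frequencies -/

section Frequencies

/-- The number of occurrences of `s` among the samples `v`. -/
def countOf {α : Type} [DecidableEq α] {m : ℕ} (v : Fin m → α) (s : α) : ℕ :=
  (Finset.univ.filter fun j => v j = s).card

theorem countOf_sub_eq {α : Type} [DecidableEq α] {m : ℕ} (v : Fin m → α) (s : α) (x : ℝ) :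
    (countOf v s : ℝ) - m * x = ∑ j, ((if v j = s then 1 else 0) - x) := by
  simp [countOf]

theorem abs_countOf_sub_le_of_eq_off {α : Type} [DecidableEq α] {m : ℕ} (i : Fin m) (v w : Fin m → α)
    (h : ∀ j, j ≠ i → v j = w j) (s : α) : |(countOf v s : ℝ) - countOf w s| ≤ 1 := by
  have e : (countOf v s : ℝ) - countOf w s =
      (if v i = s then 1 else 0) - (if w i = s then 1 else 0) := by
    simp only [countOf, Finset.card_filter]
    push_cast
    rw [← Finset.sum_sub_distrib, Finset.sum_eq_single i]
    · intro j _ hj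
      rw [h j hj, sub_self]
    · simp
  rw [e]
  split_ifs <;> simp

variable {α : Type} [Fintype α]

theorem expect_sum_of_centered (μ : PMF α) (h : α → ℝ) (h0 : ∑ a, (μ a).toReal * h a = 0) (m : ℕ) :
    expect μ m (fun v => ∑ j, h (v j)) = 0 := by
  induction m with
  | zero => simp [expect_zero]
  | succ m ih =>
    simp only [expect_succ, Fin.sum_univ_succ, Fin.cons_zero, Fin.cons_succ, expect_add, ih,
      expect_const, add_zero, h0]

theorem expect_sq_sum_of_centered (μ : PMF α) (h : α → ℝ) (h0 : ∑ a, (μ a).toReal * h a = 0)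
    (m : ℕ) :
    expect μ m (fun v => (∑ j, h (v j)) ^ 2) = m * ∑ a, (μ a).toReal * h a ^ 2 := by
  induction m with
  | zero => simp [expect_zero]
  | succ m ih =>
    have hsq : ∀ x y : ℝ, (x + y) ^ 2 = (x ^ 2 + 2 * x * y) + y ^ 2 := fun x y => by ring
    simp only [expect_succ, Fin.sum_univ_succ, Fin.cons_zero, Fin.cons_succ, hsq, expect_add, ih,
      expect_const, expect_const_mul, expect_sum_of_centered μ h h0, mul_zero, add_zero, mul_add,
      Finset.sum_add_distrib, ← Finset.sum_mul, sum_toReal]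
    push_cast
    ring

variable [DecidableEq α]

/-- Each count has variance at most m times the probability of its outcome, and these add up to m.
The number of outcomes does not enter. -/
theorem sum_expect_sq_countOf_sub_le (μ : PMF α) (m : ℕ) :
    ∑ s, expect μ m (fun v => ((countOf v s : ℝ) - m * (μ s).toReal) ^ 2) ≤ m := by
  have h : ∀ s, expect μ m (fun v => ((countOf v s : ℝ) - m * (μ s).toReal) ^ 2) ≤
      m * (μ s).toReal := by
    intro s
    simp only [countOf_sub_eq]
    rw [expect_sq_sum_of_centered μ fun a => (if a = s then 1 else 0) - (μ s).toReal]
    · refine mul_le_mul_of_nonneg_left ?_ (Nat.cast_nonneg m)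
      have e : ∀ a, (μ a).toReal * ((if a = s then 1 else 0) - (μ s).toReal) ^ 2 =
          (if a = s then (μ a).toReal * (1 - 2 * (μ s).toReal) else 0) +
            (μ a).toReal * (μ s).toReal ^ 2 := by
        intro a
        split_ifs <;> ring
      simp only [e, Finset.sum_add_distrib, ← Finset.sum_mul, sum_toReal, Finset.sum_ite_eq',
        Finset.mem_univ, if_true]
      nlinarith [sq_nonneg (μ s).toReal]
    · simp [mul_sub, ← Finset.sum_mul, sum_toReal]
  calc _ ≤ ∑ s, m * (μ s).toReal := Finset.sum_le_sum fun s _ => h s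
    _ = m := by rw [← Finset.mul_sum, sum_toReal, mul_one]

/-- The largest deviation of a count has mean at most √m and changes by at most 1 with one sample,
so McDiarmid applies to the maximum itself. This replaces a union bound over the 2ⁿ outcomes of a
basis; `hl` provides the room to absorb √m. -/
theorem expect_exists_deviation_le (μ : PMF α) (m : ℕ) {η l : ℝ} (hη : 0 < η) (hl : 2 ≤ l)
    (hm : 2 * l / η ^ 2 ≤ m) :
    expect μ m (Set.indicator {v | ∃ s, η < |(countOf v s : ℝ) / m - (μ s).toReal|} 1) ≤
      Real.exp (-l) := by
  obtain ⟨a₀, -⟩ := μ.support_nonempty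
  have : Nonempty α := ⟨a₀⟩
  have hm0 : (0 : ℝ) < m := lt_of_lt_of_le (by positivity) hm
  set F : (Fin m → α) → ℝ := fun v =>
    Finset.univ.sup' Finset.univ_nonempty fun s => |(countOf v s : ℝ) - m * (μ s).toReal| with hF
  have hFle : ∀ v s, |(countOf v s : ℝ) - m * (μ s).toReal| ≤ F v := fun v s =>
    Finset.le_sup' (fun s => |(countOf v s : ℝ) - m * (μ s).toReal|) (Finset.mem_univ s)
  have hFex : ∀ v, ∃ s, F v = |(countOf v s : ℝ) - m * (μ s).toReal| := by
    intro v
    obtain ⟨s, -, hs⟩ := Finset.exists_mem_eq_sup' Finset.univ_nonempty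
      fun s => |(countOf v s : ℝ) - m * (μ s).toReal|
    exact ⟨s, hs⟩
  have hdiff : ∀ i v w, (∀ j, j ≠ i → v j = w j) → F v - F w ≤ 1 := by
    intro i v w h
    obtain ⟨s, hs⟩ := hFex v
    have h1 := hFle w s
    have h2 := abs_countOf_sub_le_of_eq_off i v w h s
    have h3 := abs_sub_abs_le_abs_sub ((countOf v s : ℝ) - m * (μ s).toReal)
      ((countOf w s : ℝ) - m * (μ s).toReal)
    rw [sub_sub_sub_cancel_right] at h3
    linarith
  have hbdd : ∀ i v w, (∀ j, j ≠ i → v j = w j) → |F v - F w| ≤ 1 := fun i v w h =>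
    abs_le.mpr ⟨by linarith [hdiff i w v fun j hj => (h j hj).symm], hdiff i v w h⟩
  -- The square of the maximum is at most the sum of the squares.
  have hmean : expect μ m F ≤ √m := by
    refine Real.le_sqrt_of_sq_le ((sq_expect_le μ m F).trans ?_)
    refine le_trans (le_trans (expect_mono μ m fun v => ?_)
      (expect_sum μ m Finset.univ fun s v =>
        ((countOf v s : ℝ) - m * (μ s).toReal) ^ 2).le) (sum_expect_sq_countOf_sub_le μ m)
    obtain ⟨s, hs⟩ := hFex v
    rw [hs, sq_abs]
    exact Finset.single_le_sum
      (f := fun s => ((countOf v s : ℝ) - m * (μ s).toReal) ^ 2)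
      (fun s _ => sq_nonneg _) (Finset.mem_univ s)
  have hsm : √(m : ℝ) ^ 2 = m := Real.sq_sqrt hm0.le
  have hsm0 : 0 < √(m : ℝ) := Real.sqrt_pos.mpr hm0
  -- `b ≥ √(2 l)` and `2 (√(2 l) - 1) ^ 2 ≥ l`
  set b := √(m : ℝ) * η with hb
  have hb2 : 2 * l ≤ b ^ 2 := by
    rw [hb, mul_pow, hsm]
    exact (div_le_iff₀ (by positivity)).mp hm
  have hb0 : 0 < b := by positivity
  have hb3 : 2 ≤ b := by nlinarith
  have hbl : l ≤ 2 * (b - 1) ^ 2 := by nlinarith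
  -- The minimizer of the Chernoff exponent t (√m - m η) + m t² / 8, with minimum -2 (b - 1)².
  set t := 4 * (b - 1) / √(m : ℝ) with ht
  have ht0 : 0 ≤ t := div_nonneg (by linarith) hsm0.le
  calc expect μ m (Set.indicator {v | ∃ s, η < |(countOf v s : ℝ) / m - (μ s).toReal|} 1)
      ≤ expect μ m fun v => Real.exp (t * (expect μ m F - m * η)) *
          Real.exp (t * (F v - expect μ m F)) := by
        refine expect_mono μ m fun v => ?_
        rw [← Real.exp_add]
        refine Set.indicator_apply_le' (fun ⟨s, hs⟩ => ?_) fun _ => (Real.exp_pos _).le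
        rw [Pi.one_apply, Real.one_le_exp_iff]
        have e : (countOf v s : ℝ) / m - (μ s).toReal =
            ((countOf v s : ℝ) - m * (μ s).toReal) / m := by field_simp
        rw [e, abs_div, abs_of_pos hm0, lt_div_iff₀ hm0] at hs
        have : 0 ≤ t * (F v - m * η) := mul_nonneg ht0 (by linarith [hFle v s])
        linarith
    _ ≤ Real.exp (t * (expect μ m F - m * η)) * Real.exp (m * (1 ^ 2 * t ^ 2 / 8)) := by
        rw [expect_const_mul]
        exact mul_le_mul_of_nonneg_left (expect_exp_le μ t m F hbdd) (Real.exp_pos _).le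
    _ ≤ Real.exp (-l) := by
        rw [← Real.exp_add, Real.exp_le_exp]
        have h1 : t * (expect μ m F - m * η) ≤ t * (√m - m * η) :=
          mul_le_mul_of_nonneg_left (by linarith) ht0
        have h2 : t * (√m - m * η) = -(4 * (b - 1) ^ 2) := by
          have : (m : ℝ) * η = √m * b := by rw [hb, ← mul_assoc, ← sq, hsm]
          rw [this, ht]
          field_simp
          ring
        have h3 : (m : ℝ) * (1 ^ 2 * t ^ 2 / 8) = 2 * (b - 1) ^ 2 := by
          rw [ht, div_pow, hsm]
          field_simp
          ring
        linarith

end Frequencies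

/-! ### Events of composed randomized procedures -/

open scoped ENNReal

theorem toOuterMeasure_univ {α : Type} (μ : PMF α) : μ.toOuterMeasure Set.univ = 1 := by
  rw [PMF.toOuterMeasure_apply_eq_one_iff]
  exact Set.subset_univ _

theorem toOuterMeasure_le_one {α : Type} (μ : PMF α) (s : Set α) : μ.toOuterMeasure s ≤ 1 := by
  rw [← toOuterMeasure_univ μ]
  exact μ.toOuterMeasure.mono (Set.subset_univ s)

theorem one_sub_toOuterMeasure_compl_le {α : Type} (μ : PMF α) (s : Set α) :
    1 - μ.toOuterMeasure sᶜ ≤ μ.toOuterMeasure s := by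
  rw [tsub_le_iff_right, ← toOuterMeasure_univ μ, ← Set.union_compl_self s]
  exact MeasureTheory.measure_union_le _ _

/-- The union bound for a two-stage procedure: either the first stage lands in B, or the second
fails with probability at most c. -/
theorem toOuterMeasure_bind_le {α β : Type} (μ : PMF α) (f : α → PMF β) (B : Set α) (s : Set β)
    (c : ℝ≥0∞) (h : ∀ a ∉ B, (f a).toOuterMeasure s ≤ c) :
    (μ.bind f).toOuterMeasure s ≤ μ.toOuterMeasure B + c := by
  rw [PMF.toOuterMeasure_bind_apply, PMF.toOuterMeasure_apply]
  calc ∑' a, μ a * (f a).toOuterMeasure s ≤ ∑' a, (B.indicator μ a + μ a * c) := by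
        refine ENNReal.tsum_le_tsum fun a => ?_
        by_cases ha : a ∈ B
        · rw [Set.indicator_of_mem ha]
          exact (mul_le_of_le_one_right' (toOuterMeasure_le_one _ _)).trans le_self_add
        · rw [Set.indicator_of_notMem ha, zero_add]
          exact mul_le_mul_right (h a ha) _
    _ = _ := by rw [ENNReal.tsum_add, ENNReal.tsum_mul_right, μ.tsum_coe, one_mul]

theorem toOuterMeasure_bind_pure {α β : Type} (μ : PMF α) (f : α → β) (s : Set β) :
    (μ.bind fun a => PMF.pure (f a)).toOuterMeasure s = μ.toOuterMeasure (f ⁻¹' s) :=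
  PMF.toOuterMeasure_map_apply f μ s

theorem toOuterMeasure_bind_bind_pure_le {α β γ : Type} (μ : PMF α) (ν : PMF β) (f : α → β → γ)
    (A : Set α) (B : Set β) (s : Set γ) (h : ∀ a b, f a b ∈ s → a ∈ A ∧ b ∈ B) :
    (μ.bind fun a => ν.bind fun b => PMF.pure (f a b)).toOuterMeasure s ≤
      μ.toOuterMeasure A * ν.toOuterMeasure B := by
  rw [PMF.toOuterMeasure_bind_apply, PMF.toOuterMeasure_apply, ← ENNReal.tsum_mul_right]
  refine ENNReal.tsum_le_tsum fun a => ?_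
  rw [toOuterMeasure_bind_pure]
  by_cases ha : a ∈ A
  · rw [Set.indicator_of_mem ha]
    exact mul_le_mul_right (ν.toOuterMeasure.mono fun b hb => (h a b hb).2) _
  · have : f a ⁻¹' s = ∅ := Set.eq_empty_of_forall_notMem fun b hb => ha (h a b hb).1
    simp [this]

theorem iid_succ {α : Type} (μ : PMF α) (m : ℕ) : iid μ (m + 1) =
    μ.bind fun a => (iid μ m).bind fun v => PMF.pure (Fin.cons a v : Fin (m + 1) → α) :=
  rfl

theorem toOuterMeasure_iid_exists_le {α : Type} (μ : PMF α) (B : Set α) (m : ℕ) :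
    (iid μ m).toOuterMeasure {v | ∃ j, v j ∈ B} ≤ m * μ.toOuterMeasure B := by
  induction m with
  | zero => simp
  | succ m ih =>
    rw [iid_succ]
    refine (toOuterMeasure_bind_le μ _ B _
      (m * μ.toOuterMeasure B) fun a ha => ?_).trans ?_
    · rw [toOuterMeasure_bind_pure]
      refine le_trans ((iid μ m).toOuterMeasure.mono ?_) ih
      rintro v ⟨j, hj⟩
      revert hj
      refine Fin.cases ?_ (fun i hi => ?_) j
      · exact fun hj => absurd (by simpa using hj) ha
      · exact ⟨i, by simpa using hi⟩
    · push_cast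
      rw [add_mul, one_mul, add_comm]

theorem toOuterMeasure_iid_forall_le {α : Type} (μ : PMF α) (B : Set α) (m : ℕ) :
    (iid μ m).toOuterMeasure {v | ∀ j, v j ∈ B} ≤ μ.toOuterMeasure B ^ m := by
  induction m with
  | zero => exact (toOuterMeasure_le_one _ _).trans (pow_zero _).ge
  | succ m ih =>
    rw [pow_succ', iid_succ]
    refine (toOuterMeasure_bind_bind_pure_le μ (iid μ m)
      (fun a v => (Fin.cons a v : Fin (m + 1) → α)) B
      {v | ∀ j, v j ∈ B} {v | ∀ j, v j ∈ B} fun a v hv => ⟨?_, fun j => ?_⟩).trans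
      (mul_le_mul_right ih _)
    · simpa using hv 0
    · simpa using hv j.succ

theorem toOuterMeasure_forEach_exists_le {α β : Type} (f : α → PMF β) (B : Set β) (c : ℝ≥0∞)
    (h : ∀ a, (f a).toOuterMeasure B ≤ c) (l : List α) :
    (forEach f l).toOuterMeasure {bs | ∃ b ∈ bs, b ∈ B} ≤ l.length * c := by
  induction l with
  | nil =>
    change (PMF.pure ([] : List β)).toOuterMeasure _ ≤ _
    simp [PMF.toOuterMeasure_pure_apply]
  | cons a l ih =>
    refine (toOuterMeasure_bind_le (f a)
      (fun b => (forEach f l).bind fun bs => PMF.pure (b :: bs)) B _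
      (l.length * c) fun b hb => ?_).trans ?_
    · rw [toOuterMeasure_bind_pure]
      refine le_trans ((forEach f l).toOuterMeasure.mono ?_) ih
      rintro bs ⟨b', hb', hB⟩
      rcases List.mem_cons.mp hb' with rfl | hb'
      · exact absurd hB hb
      · exact ⟨b', hb', hB⟩
    · rw [List.length_cons]
      push_cast
      rw [add_mul, one_mul, add_comm]
      gcongr
      exact h a

/-- Meant for B = `missing φ`: one visit to the right basis is enough for φ to be recorded almost
surely. -/
theorem toOuterMeasure_forEach_forall_eq_zero {α β : Type} (f : α → PMF β) (B : Set β) {a : α}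
    (h : (f a).toOuterMeasure B = 0) {l : List α} (ha : a ∈ l) :
    (forEach f l).toOuterMeasure {bs | ∀ b ∈ bs, b ∈ B} = 0 := by
  induction l with
  | nil => simp at ha
  | cons a' l ih =>
    have key := toOuterMeasure_bind_bind_pure_le (f a') (forEach f l) (fun b bs => b :: bs) B
      {bs | ∀ b ∈ bs, b ∈ B} {bs | ∀ b ∈ bs, b ∈ B} fun b bs hb => by simpa using hb
    refine le_antisymm (key.trans (le_of_eq ?_)) (zero_le)
    rcases List.mem_cons.mp ha with rfl | ha
    · rw [h, zero_mul]
    · rw [ih ha, mul_zero]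

open scoped ComplexOrder

/-! ### Pauli coefficients and Bell difference sampling -/

/-- The sign `(-1)^c` as a real number. -/
def realSign (c : ZMod 2) : ℝ := (-1) ^ c.val

theorem sign_eq_realSign (c : ZMod 2) : sign c = (realSign c : ℂ) := by
  simp [sign, realSign]

theorem realSign_add (c d : ZMod 2) : realSign (c + d) = realSign c * realSign d := by
  have := sign_add c d
  simp only [sign_eq_realSign] at this
  exact_mod_cast this

theorem abs_realSign (c : ZMod 2) : |realSign c| = 1 := by
  simp [realSign, abs_pow]

theorem realSign_sum {ι : Type} (s : Finset ι) (f : ι → ZMod 2) :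
    realSign (∑ i ∈ s, f i) = ∏ i ∈ s, realSign (f i) := by
  classical
  induction s using Finset.induction_on with
  | empty => simp [realSign]
  | insert a s ha ih => rw [Finset.sum_insert ha, Finset.prod_insert ha, realSign_add, ih]

theorem weyl_conjTranspose {n : ℕ} (a : F2 n) : (weyl a)ᴴ = weyl a := by
  simp only [weyl_eq, tensor_conjTranspose, pauli_conjTranspose]

theorem pauli_mul_self (c : ZMod 2 × ZMod 2) : pauli c * pauli c = 1 := by
  obtain ⟨a, b⟩ := c
  fin_cases a <;> fin_cases b <;> ext i j <;> fin_cases i <;> fin_cases j <;>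
    simp [pauli, pauliX, pauliZ, ZMod.val]

theorem weyl_mul_self {n : ℕ} (a : F2 n) : weyl a * weyl a = 1 := by
  simp only [weyl_eq, tensor_mul, pauli_mul_self, tensor_one]

section

variable {n : ℕ} (ρ : Density (Qubits n))

/-- The Pauli coefficient `tr (W_a ρ)`. -/
noncomputable def pauliCoeff (a : F2 n) : ℝ := (weyl a * ρ.mat).trace.re

theorem trace_weyl_mul (a : F2 n) : (weyl a * ρ.mat).trace = (pauliCoeff ρ a : ℂ) := by
  have h : (starRingEnd ℂ) (weyl a * ρ.mat).trace = (weyl a * ρ.mat).trace := by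
    have h1 : star (weyl a * ρ.mat).trace = (weyl a * ρ.mat).trace := by
      rw [← Matrix.trace_conjTranspose, Matrix.conjTranspose_mul, weyl_conjTranspose,
        ρ.posSemidef.1.eq, Matrix.trace_mul_comm]
    exact h1
  exact (Complex.conj_eq_iff_re.mp h).symm

/-- For c = ±1 the square of 1 + c W is 2 (1 + c W), so its nonnegative expectation bounds the
coefficient on both sides. -/
theorem sq_pauliCoeff_le_one (a : F2 n) : pauliCoeff ρ a ^ 2 ≤ 1 := by
  have key : ∀ c : ℝ, c ^ 2 = 1 → 0 ≤ 1 + c * pauliCoeff ρ a := by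
    intro c hc
    have h := born_nonneg (Matrix.posSemidef_conjTranspose_mul_self (1 + (c : ℂ) • weyl a))
      ρ.posSemidef
    have e : (1 + (c : ℂ) • weyl a)ᴴ * (1 + (c : ℂ) • weyl a) =
        (2 : ℂ) • (1 : Matrix (Qubits n) (Qubits n) ℂ) + (2 * c : ℂ) • weyl a := by
      have hc' : (c : ℂ) * c = 1 := by exact_mod_cast (by rw [← sq]; exact hc)
      simp only [Matrix.conjTranspose_add, Matrix.conjTranspose_smul, weyl_conjTranspose,
        Matrix.conjTranspose_one, Matrix.mul_add, Matrix.add_mul, Matrix.smul_mul, Matrix.mul_smul,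
        weyl_mul_self, Matrix.one_mul, Matrix.mul_one, RCLike.star_def, Complex.conj_ofReal]
      simp only [smul_add, smul_smul, hc', one_smul]
      module
    rw [e, Matrix.add_mul, Matrix.smul_mul, Matrix.smul_mul, Matrix.one_mul, Matrix.trace_add,
      Matrix.trace_smul, Matrix.trace_smul, trace_weyl_mul, ρ.trace_eq_one] at h
    simp at h
    linarith
  have h1 := key 1 (by norm_num)
  have h2 := key (-1) (by norm_num)
  nlinarith

theorem bellDifferenceSampling_toReal (x : F2 n) :
    (bellDifferenceSampling ρ x).toReal =
      1 / 4 ^ n * ∑ a : F2 n, realSign (symp x a) * pauliCoeff ρ a ^ 4 := by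
  have hre : (bellEffect x * (ρ.copies 4).mat).trace =
      ((1 / 4 ^ n * ∑ a : F2 n, realSign (symp x a) * pauliCoeff ρ a ^ 4 : ℝ) : ℂ) := by
    have h4 : ∀ a : F2 n, (weyl4 a * (ρ.copies 4).mat).trace = (pauliCoeff ρ a : ℂ) ^ 4 := by
      intro a
      simp only [weyl4, Density.copies, tensor_mul, trace_tensor, trace_weyl_mul]
      simp
    simp only [bellEffect, Matrix.smul_mul, Finset.sum_mul, Matrix.trace_smul, Matrix.trace_sum,
      h4, smul_eq_mul, sign_eq_realSign]
    push_cast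
    rfl
  have h : bellDifferenceSampling ρ x =
      ENNReal.ofReal (bellEffect x * (ρ.copies 4).mat).trace.re := rfl
  have hnn : 0 ≤ (bellEffect x * (ρ.copies 4).mat).trace.re :=
    born_nonneg ((bellMeasurement n).posSemidef x) (ρ.copies 4).posSemidef
  rw [h, ENNReal.toReal_ofReal hnn, hre, Complex.ofReal_re]

theorem sum_pauli_mul_pauli (u v u' v' : Fin 2) :
    ∑ c : ZMod 2 × ZMod 2, pauli c u v * pauli c u' v' = if u = v' ∧ v = u' then 2 else 0 := by
  have hv1 : (1 : ZMod 2).val = 1 := rfl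
  rw [Fintype.sum_prod_type]
  have h2 : ∀ f : ZMod 2 → ℂ, ∑ a, f a = f 0 + f 1 := fun f => Fin.sum_univ_two f
  simp only [h2]
  fin_cases u <;> fin_cases v <;> fin_cases u' <;> fin_cases v' <;>
    simp [pauli, pauliX, pauliZ, hv1] <;> norm_num

/-- Completeness of the Pauli operators: the sum of W ⊗ W is 2ⁿ times the swap operator, computed
qubit by qubit. -/
theorem sum_weyl_mul_weyl (u v u' v' : Qubits n) :
    ∑ a : F2 n, weyl a u v * weyl a u' v' = if u = v' ∧ v = u' then 2 ^ n else 0 := by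
  rw [← Equiv.sum_comp (Equiv.arrowProdEquivProdArrow (Fin n) (fun _ => ZMod 2) fun _ => ZMod 2)]
  simp only [weyl_eq, tensor, Matrix.of_apply, ← Finset.prod_mul_distrib]
  have h := Fintype.prod_sum fun (i : Fin n) (c : ZMod 2 × ZMod 2) =>
    pauli c (u i) (v i) * pauli c (u' i) (v' i)
  have e : ∀ x : Fin n → ZMod 2 × ZMod 2, ∀ i, F2.at
      (Equiv.arrowProdEquivProdArrow (Fin n) (fun _ => ZMod 2) (fun _ => ZMod 2) x) i = x i :=
    fun x i => rfl
  simp only [e, ← h, sum_pauli_mul_pauli, Finset.prod_ite_zero, Finset.prod_const,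
    Finset.card_univ, Fintype.card_fin, Finset.mem_univ, true_implies, funext_iff, forall_and]

/-- Cauchy–Schwarz for the columns of a factor B of ρ bounds |ρ_uv|² by ρ_uu ρ_vv. -/
theorem trace_mul_self_le_one : (ρ.mat * ρ.mat).trace.re ≤ 1 := by
  obtain ⟨B, hB⟩ := exists_factor ρ.posSemidef
  have hd : ∀ u, (ρ.mat u u).re = ∑ k, ‖B k u‖ ^ 2 := by
    intro u
    rw [hB, Matrix.mul_apply, Complex.re_sum]
    refine Finset.sum_congr rfl fun k _ => ?_
    rw [Matrix.conjTranspose_apply, RCLike.star_def, ← Complex.normSq_eq_conj_mul_self,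
      Complex.ofReal_re, Complex.normSq_eq_norm_sq]
  have hcs : ∀ u v, ‖ρ.mat u v‖ ^ 2 ≤ (ρ.mat u u).re * (ρ.mat v v).re := by
    intro u v
    rw [hd, hd]
    refine le_trans ?_ (Finset.sum_mul_sq_le_sq_mul_sq _ _ _)
    refine pow_le_pow_left₀ (norm_nonneg _) ?_ 2
    rw [hB, Matrix.mul_apply]
    refine (norm_sum_le _ _).trans (le_of_eq (Finset.sum_congr rfl fun k _ => ?_))
    rw [norm_mul, Matrix.conjTranspose_apply, norm_star]
  have ht : ∑ u, (ρ.mat u u).re = 1 := by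
    have := congrArg Complex.re ρ.trace_eq_one
    simpa [Matrix.trace] using this
  calc (ρ.mat * ρ.mat).trace.re = ∑ u, ∑ v, ‖ρ.mat u v‖ ^ 2 := by
        rw [Matrix.trace, Complex.re_sum]
        refine Finset.sum_congr rfl fun u _ => ?_
        rw [Matrix.diag_apply, Matrix.mul_apply, Complex.re_sum]
        refine Finset.sum_congr rfl fun v _ => ?_
        rw [← ρ.posSemidef.1.apply v u, RCLike.star_def, Complex.mul_conj, Complex.ofReal_re,
          Complex.normSq_eq_norm_sq]
    _ ≤ ∑ u, ∑ v, (ρ.mat u u).re * (ρ.mat v v).re :=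
        Finset.sum_le_sum fun u _ => Finset.sum_le_sum fun v _ => hcs u v
    _ = 1 := by rw [← Finset.sum_mul_sum, ht, one_mul]

theorem sum_sq_pauliCoeff_le : ∑ a : F2 n, pauliCoeff ρ a ^ 2 ≤ 2 ^ n := by
  have h : ((∑ a : F2 n, pauliCoeff ρ a ^ 2 : ℝ) : ℂ) = 2 ^ n * (ρ.mat * ρ.mat).trace := by
    push_cast
    simp only [← trace_weyl_mul, sq, Matrix.trace, Matrix.diag_apply, Matrix.mul_apply]
    calc ∑ a : F2 n, (∑ u, ∑ v, weyl a u v * ρ.mat v u) * (∑ u, ∑ v, weyl a u v * ρ.mat v u)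
        = ∑ a : F2 n, ∑ u, ∑ v, ∑ u', ∑ v', (weyl a u v * weyl a u' v') *
            (ρ.mat v u * ρ.mat v' u') := by
          refine Finset.sum_congr rfl fun a _ => ?_
          simp only [Finset.sum_mul, Finset.mul_sum]
          exact Finset.sum_congr rfl fun u _ => Finset.sum_congr rfl fun v _ =>
            Finset.sum_congr rfl fun u' _ => Finset.sum_congr rfl fun v' _ => by ring
      _ = ∑ u, ∑ v, ∑ u', ∑ v', (∑ a : F2 n, weyl a u v * weyl a u' v') *
            (ρ.mat v u * ρ.mat v' u') := by
          simp only [Finset.sum_mul]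
          rw [Finset.sum_comm]
          refine Finset.sum_congr rfl fun u _ => ?_
          rw [Finset.sum_comm]
          refine Finset.sum_congr rfl fun v _ => ?_
          rw [Finset.sum_comm]
          refine Finset.sum_congr rfl fun u' _ => ?_
          rw [Finset.sum_comm]
      _ = ∑ u, ∑ v, 2 ^ n * (ρ.mat v u * ρ.mat u v) := by
          refine Finset.sum_congr rfl fun u _ => Finset.sum_congr rfl fun v _ => ?_
          simp only [sum_weyl_mul_weyl]
          rw [Finset.sum_eq_single v, Finset.sum_eq_single u]
          · simp
          · intro v' _ hv'
            simp [hv'.symm]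
          · simp
          · intro u' _ hu'
            simp [hu'.symm]
          · simp
      _ = 2 ^ n * ∑ u, ∑ v, ρ.mat u v * ρ.mat v u := by
          simp only [Finset.mul_sum]
          exact Finset.sum_congr rfl fun u _ => Finset.sum_congr rfl fun v _ => by ring
  have h2 := congrArg Complex.re h
  have e : ((2 : ℂ) ^ n * (ρ.mat * ρ.mat).trace).re = 2 ^ n * (ρ.mat * ρ.mat).trace.re := by
    rw [show ((2 : ℂ) ^ n) = ((2 ^ n : ℝ) : ℂ) by push_cast; rfl, Complex.re_ofReal_mul]
  rw [Complex.ofReal_re, e] at h2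
  rw [h2]
  exact mul_le_of_le_one_right (by positivity) (trace_mul_self_le_one ρ)

/-- Coefficients are at most 1 in absolute value, so fourth powers are at most squares, whose sum is
2ⁿ tr ρ² ≤ 2ⁿ. This is the min-entropy input of the entropy bound. -/
theorem bellDifferenceSampling_le (x : F2 n) :
    (bellDifferenceSampling ρ x).toReal ≤ 1 / 2 ^ n := by
  rw [bellDifferenceSampling_toReal]
  calc (1 : ℝ) / 4 ^ n * ∑ a : F2 n, realSign (symp x a) * pauliCoeff ρ a ^ 4
      ≤ 1 / 4 ^ n * ∑ a : F2 n, pauliCoeff ρ a ^ 2 := by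
        refine mul_le_mul_of_nonneg_left (Finset.sum_le_sum fun a _ => ?_) (by positivity)
        have h1 := sq_pauliCoeff_le_one ρ a
        have h2 : realSign (symp x a) ≤ 1 := (le_abs_self _).trans (abs_realSign _).le
        calc realSign (symp x a) * pauliCoeff ρ a ^ 4 ≤ 1 * pauliCoeff ρ a ^ 4 :=
              mul_le_mul_of_nonneg_right h2 (by positivity)
          _ = pauliCoeff ρ a ^ 2 * pauliCoeff ρ a ^ 2 := by ring
          _ ≤ pauliCoeff ρ a ^ 2 := mul_le_of_le_one_right (sq_nonneg _) h1
    _ ≤ 1 / 4 ^ n * 2 ^ n :=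
        mul_le_mul_of_nonneg_left (sum_sq_pauliCoeff_le ρ) (by positivity)
    _ = 1 / 2 ^ n := by
        rw [show (4 : ℝ) = 2 * 2 by norm_num, mul_pow]
        field_simp

/-! ### The weight of a stabilizer product group -/

/-- The element of `{I, P₁} ⊗ ⋯ ⊗ {I, Pₙ}` that is not the identity exactly where `z` is true. -/
def groupElement (P : Fin n → Axis) (z : Fin n → Bool) : F2 n :=
  (fun i => if z i then (P i).label.1 else 0, fun i => if z i then (P i).label.2 else 0)

theorem groupElement_at (P : Fin n → Axis) (z : Fin n → Bool) (i : Fin n) :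
    (groupElement P z).at i = if z i then (P i).label else 0 := by
  cases h : z i <;> simp [F2.at, groupElement, h]

theorem Axis.label_ne_zero (P : Axis) : P.label ≠ 0 := by
  cases P <;> decide

theorem F2.ext_at {x y : F2 n} (h : ∀ i, x.at i = y.at i) : x = y :=
  Prod.ext (funext fun i => congrArg Prod.fst (h i)) (funext fun i => congrArg Prod.snd (h i))

theorem groupElement_injective (P : Fin n → Axis) : Function.Injective (groupElement P) := by
  intro z w h
  ext i
  have := congrArg (fun x => F2.at x i) h
  simp only [groupElement_at] at this
  have hl := (P i).label_ne_zero
  generalize z i = a at this ⊢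
  generalize w i = b at this ⊢
  cases a <;> cases b <;> simp [hl, hl.symm] at this ⊢

theorem mem_productGroup {P : Fin n → Axis} {x : F2 n} :
    x ∈ productGroup P ↔ ∀ i, x.at i = 0 ∨ x.at i = (P i).label := by
  simp [productGroup]

theorem productGroup_eq_image (P : Fin n → Axis) :
    productGroup P = Finset.univ.image (groupElement P) := by
  classical
  ext x
  rw [mem_productGroup, Finset.mem_image]
  constructor
  · intro h
    refine ⟨fun i => decide (x.at i ≠ 0), Finset.mem_univ _, F2.ext_at fun i => ?_⟩
    rw [groupElement_at]
    rcases h i with h | h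
    · simp [h]
    · simp [h, (P i).label_ne_zero]
  · rintro ⟨z, -, rfl⟩ i
    rw [groupElement_at]
    cases z i <;> simp

theorem sum_productGroup (P : Fin n → Axis) (f : F2 n → ℝ) :
    ∑ x ∈ productGroup P, f x = ∑ z, f (groupElement P z) := by
  rw [productGroup_eq_image, Finset.sum_image fun _ _ _ _ h => groupElement_injective P h]

/-- The group is its own symplectic complement. The sum factors over qubits, each factor being 2 or
0. -/
theorem sum_productGroup_realSign (P : Fin n → Axis) (a : F2 n) :
    ∑ x ∈ productGroup P, realSign (symp x a) = if a ∈ productGroup P then 2 ^ n else 0 := by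
  have h1 : ∀ (Q : Axis) (c : ZMod 2 × ZMod 2),
      1 + realSign (Q.label.1 * c.2 + Q.label.2 * c.1) = if c = 0 ∨ c = Q.label then 2 else 0 := by
    have hv1 : (1 : ZMod 2).val = 1 := rfl
    have h2 : (1 : ZMod 2) + 1 = 0 := by decide
    have hz : ∀ a : ZMod 2, a = 0 ∨ a = 1 := by decide
    rintro Q ⟨a, b⟩
    rcases hz a with rfl | rfl <;> rcases hz b with rfl | rfl <;> cases Q <;>
      simp [realSign, Axis.label, hv1, h2] <;> norm_num
  have h2 := Fintype.prod_sum fun (i : Fin n) (b : Bool) =>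
    realSign ((if b then (P i).label.1 else 0) * (a.at i).2 +
      (if b then (P i).label.2 else 0) * (a.at i).1)
  simp only [sum_productGroup, symp, realSign_sum]
  refine h2.symm.trans ?_
  have h3 : realSign 0 = 1 := by simp [realSign]
  simp only [Fintype.sum_bool, Bool.false_eq_true, if_true, if_false, zero_mul, add_zero, h3]
  simp only [add_comm _ (1 : ℝ), h1, Finset.prod_ite_zero, mem_productGroup, Finset.mem_univ,
    true_implies, Finset.prod_const, Finset.card_univ, Fintype.card_fin]

/-- Poisson summation over a self-dual group. -/
theorem sum_productGroup_bellDifferenceSampling (P : Fin n → Axis) :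
    ∑ x ∈ productGroup P, (bellDifferenceSampling ρ x).toReal =
      1 / 2 ^ n * ∑ a ∈ productGroup P, pauliCoeff ρ a ^ 4 := by
  simp only [bellDifferenceSampling_toReal, ← Finset.mul_sum]
  rw [Finset.sum_comm]
  simp only [← Finset.sum_mul, sum_productGroup_realSign, ite_mul, zero_mul,
    Finset.sum_ite_mem, Finset.univ_inter, ← Finset.mul_sum]
  rw [← mul_assoc]
  congr 1
  rw [show (4 : ℝ) = 2 * 2 by norm_num, mul_pow]
  field_simp

theorem ket_mul_star_ket (P : Axis) (b : Bool) (u v : Fin 2) :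
    ket P b u * star (ket P b v) =
      ∑ c : Bool, (1 / 2 * (if b && c then -1 else 1) : ℂ) *
        pauli (if c then P.label else 0) u v := by
  have h : ((√2 : ℝ) : ℂ)⁻¹ * ((√2 : ℝ) : ℂ)⁻¹ = 1 / 2 := by
    rw [← mul_inv, ← Complex.ofReal_mul, Real.mul_self_sqrt (by norm_num)]
    norm_num
  have hv1 : (1 : ZMod 2).val = 1 := rfl
  cases P <;> cases b <;> fin_cases u <;> fin_cases v <;>
    simp [ket, div_eq_mul_inv, mul_mul_mul_comm, h, pauli, pauliX, pauliZ, Axis.label, hv1] <;>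
    first
    | norm_num; done
    | linear_combination Complex.I * h

/-- The tensor product of the single-qubit identities |ψ⟩⟨ψ| = (I ± P)/2, expanded. -/
theorem vecMulVec_basisState (P : Fin n → Axis) (s : Fin n → Bool) :
    Matrix.vecMulVec (basisState P s).vec (star (basisState P s).vec) =
      ∑ z : Fin n → Bool, (∏ i, (1 / 2 * (if s i && z i then -1 else 1) : ℂ)) •
        weyl (groupElement P z) := by
  ext u v
  simp only [Matrix.sum_apply, Matrix.smul_apply, Matrix.vecMulVec_apply, SP.vec, tensorVec,
    basisState, Pi.star_apply, star_prod, ← Finset.prod_mul_distrib, smul_eq_mul, weyl_eq, tensor,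
    Matrix.of_apply, groupElement_at, ket_mul_star_ket]
  exact Fintype.prod_sum _

theorem trace_vecMulVec_mul (φ : SP n) :
    (Matrix.vecMulVec φ.vec (star φ.vec) * ρ.mat).trace.re = fidelity ρ φ := by
  rw [fidelity, Matrix.vecMulVec_mul, Matrix.trace_vecMulVec, Matrix.dotProduct_mulVec,
    dotProduct_comm]

theorem fidelity_basisState_le (P : Fin n → Axis) (s : Fin n → Bool) :
    fidelity ρ (basisState P s) ≤ 1 / 2 ^ n * ∑ a ∈ productGroup P, |pauliCoeff ρ a| := by
  rw [← trace_vecMulVec_mul, vecMulVec_basisState, Finset.sum_mul, Matrix.trace_sum,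
    Complex.re_sum, sum_productGroup, Finset.mul_sum]
  refine Finset.sum_le_sum fun z _ => ?_
  rw [Matrix.smul_mul, Matrix.trace_smul, trace_weyl_mul, smul_eq_mul]
  refine (Complex.re_le_norm _).trans (le_of_eq ?_)
  rw [norm_mul, norm_prod, Complex.norm_real, Real.norm_eq_abs]
  congr 1
  have : ∀ i, ‖(1 / 2 * (if s i && z i then -1 else 1) : ℂ)‖ = 1 / 2 := by
    intro i
    split_ifs <;> simp
  rw [Finset.prod_congr rfl fun i _ => this i]
  simp

theorem fidelity_pow_four_le (P : Fin n → Axis) (s : Fin n → Bool)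
    (h0 : 0 ≤ fidelity ρ (basisState P s)) :
    fidelity ρ (basisState P s) ^ 4 ≤
      ∑ x ∈ productGroup P, (bellDifferenceSampling ρ x).toReal := by
  refine (pow_le_pow_left₀ h0 (fidelity_basisState_le ρ P s) 4).trans ?_
  rw [sum_productGroup_bellDifferenceSampling, sum_productGroup, sum_productGroup, Finset.mul_sum,
    Finset.mul_sum]
  have h := Real.pow_arith_mean_le_arith_mean_pow (Finset.univ : Finset (Fin n → Bool))
    (fun _ => 1 / 2 ^ n) (fun z => |pauliCoeff ρ (groupElement P z)|)
    (fun _ _ => by positivity) (by simp) (fun _ _ => abs_nonneg _) 4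
  refine h.trans (le_of_eq (Finset.sum_congr rfl fun z _ => ?_))
  rw [Even.pow_abs (by decide)]

end

/-! ### Entropy bound on the number of rarely covered qubits -/

theorem entropy_eq (p : ℝ) : entropy p = Real.binEntropy p / Real.log 2 := by
  rw [entropy, Real.binEntropy, Real.logb, Real.logb, Real.log_inv, Real.log_inv]
  ring

theorem entropy_lt_one {p : ℝ} (hp : 1 / 2 < p) : entropy p < 1 := by
  rw [entropy_eq, div_lt_one (Real.log_pos one_lt_two), Real.binEntropy_lt_log_two]
  exact fun h => by norm_num [h] at hp

/-- If a distribution on `{0, 1}ⁿ` has weight `Q` on an event and all its probabilities are at most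
`2⁻ⁿ`, then only few coordinates can be biased towards `0` on the event. -/
theorem card_mul_one_sub_entropy_le {n : ℕ} (w : (Fin n → Bool) → ℝ) (hw : ∀ z, 0 ≤ w z)
    (hwn : ∀ z, w z ≤ 1 / 2 ^ n) (hQ : 0 < ∑ z, w z) {p : ℝ} (hp : 1 / 2 < p) (hp1 : p < 1)
    (U : Finset (Fin n))
    (hU : ∀ i ∈ U, p * ∑ z, w z ≤ ∑ z with z i = false, w z) :
    U.card * (1 - entropy p) ≤ Real.logb 2 (1 / ∑ z, w z) := by
  set Q := ∑ z, w z with hQdef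
  have hl2 : 0 < Real.log 2 := Real.log_pos one_lt_two
  -- A product reference distribution: biased coordinates are 0 with probability p, the others are
  -- uniform. Gibbs' inequality against it takes the place of subadditivity of entropy.
  set f : Fin n → Bool → ℝ := fun i b => if i ∈ U then (if b then 1 - p else p) else 1 / 2 with hf
  have hfpos : ∀ i b, 0 < f i b := by
    intro i b
    simp only [hf]
    split_ifs <;> linarith
  have hfsum : ∑ z : Fin n → Bool, ∏ i, f i (z i) = 1 := by
    rw [← Fintype.prod_sum]
    refine Finset.prod_eq_one fun i _ => ?_
    rw [Fintype.sum_bool]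
    by_cases hi : i ∈ U <;> simp [hf, hi]
    norm_num
  have hlog : ∀ z : Fin n → Bool, Real.log (∏ i, f i (z i)) = ∑ i, Real.log (f i (z i)) := fun z =>
    Real.log_prod fun i _ => (hfpos i _).ne'
  -- Pointwise Gibbs: log x ≤ x - 1 at x = π(z) Q / w(z), together with log w(z) ≤ -n log 2.
  have hterm : ∀ z, w z * (∑ i, Real.log (f i (z i)) + Real.log Q + n * Real.log 2) ≤
      (∏ i, f i (z i)) * Q - w z := by
    intro z
    have hπ : 0 < ∏ i, f i (z i) := Finset.prod_pos fun i _ => hfpos i _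
    rcases (hw z).eq_or_lt with h0 | h0
    · rw [← h0]
      nlinarith
    · have h1 := Real.log_le_sub_one_of_pos (show 0 < (∏ i, f i (z i)) * Q / w z by positivity)
      rw [Real.log_div (by positivity) h0.ne', Real.log_mul hπ.ne' hQ.ne', hlog] at h1
      have h2 : Real.log (w z) ≤ -(n * Real.log 2) := by
        have := Real.log_le_log h0 (hwn z)
        rwa [one_div, Real.log_inv, Real.log_pow] at this
      have h3 := mul_le_mul_of_nonneg_left
        (show ∑ i, Real.log (f i (z i)) + Real.log Q + n * Real.log 2 ≤
          (∏ i, f i (z i)) * Q / w z - 1 by linarith) h0.le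
      refine h3.trans (le_of_eq ?_)
      field_simp
  have hsum := Finset.sum_le_sum fun z (_ : z ∈ Finset.univ) => hterm z
  rw [Finset.sum_sub_distrib, ← Finset.sum_mul, hfsum, one_mul, sub_self] at hsum
  -- The cross-entropy in a biased coordinate is at most H(p): the actual weight of 0 is at least p,
  -- and log p ≥ log (1 - p).
  have hcoord : ∀ i, (if i ∈ U then -Q * Real.binEntropy p else -Q * Real.log 2) ≤
      ∑ z, w z * Real.log (f i (z i)) := by
    intro i
    split_ifs with hi
    · have hA := hU i hi
      have hsplit := Finset.sum_filter_add_sum_filter_not Finset.univ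
        (fun z : Fin n → Bool => z i = false) w
      set A := ∑ z with z i = false, w z
      have e : ∑ z, w z * Real.log (f i (z i)) = A * Real.log p + (Q - A) * Real.log (1 - p) := by
        rw [← Finset.sum_filter_add_sum_filter_not Finset.univ
          (fun z : Fin n → Bool => z i = false)]
        have : Q - A = ∑ z with ¬ z i = false, w z := by rw [hQdef]; linarith
        rw [this, Finset.sum_mul, Finset.sum_mul]
        congr 1
        · refine Finset.sum_congr rfl fun z hz => ?_
          rw [(Finset.mem_filter.mp hz).2]
          simp [hf, hi]
        · refine Finset.sum_congr rfl fun z hz => ?_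
          rw [Bool.not_eq_false _ |>.mp (Finset.mem_filter.mp hz).2]
          simp [hf, hi]
      have hlogp : Real.log (1 - p) ≤ Real.log p := Real.log_le_log (by linarith) (by linarith)
      rw [e, Real.binEntropy, Real.log_inv, Real.log_inv]
      nlinarith [mul_nonneg (sub_nonneg.mpr hA) (sub_nonneg.mpr hlogp)]
    · simp only [hf, hi, if_false, ← Finset.sum_mul, ← hQdef, one_div, Real.log_inv]
      linarith
  have hall : -Q * (U.card * Real.binEntropy p + (n - U.card) * Real.log 2) ≤
      ∑ z, w z * ∑ i, Real.log (f i (z i)) := by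
    simp only [Finset.mul_sum]
    rw [Finset.sum_comm]
    refine le_trans (le_of_eq ?_) (Finset.sum_le_sum fun i _ => hcoord i)
    rw [Finset.sum_ite, Finset.sum_const, Finset.sum_const, Finset.filter_mem_eq_inter,
      Finset.univ_inter, Finset.filter_not, Finset.filter_mem_eq_inter, Finset.univ_inter,
      ← Finset.compl_eq_univ_sdiff, Finset.card_compl, Fintype.card_fin, nsmul_eq_mul,
      nsmul_eq_mul, Nat.cast_sub (by simpa using U.card_le_univ)]
    ring
  have hsum' : (∑ z, w z * ∑ i, Real.log (f i (z i))) + Q * (Real.log Q + n * Real.log 2) ≤ 0 := by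
    refine le_trans (le_of_eq ?_) hsum
    rw [hQdef, Finset.sum_mul, ← Finset.sum_add_distrib]
    exact Finset.sum_congr rfl fun z _ => by ring
  have hfin : U.card * (Real.log 2 - Real.binEntropy p) ≤ -Real.log Q := by
    have : Q * (U.card * (Real.log 2 - Real.binEntropy p) + Real.log Q) ≤ Q * 0 := by
      rw [mul_zero]
      linarith
    linarith [le_of_mul_le_mul_left this hQ]
  rw [Real.logb, one_div, Real.log_inv, le_div_iff₀ hl2, entropy_eq]
  refine le_trans (le_of_eq ?_) hfin
  field_simp

/-! ### The stabilizer product groups visited by the algorithm -/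

section Visited

variable {n : ℕ}

theorem Axis.label_injective : Function.Injective Axis.label := by
  intro P Q h
  cases P <;> cases Q <;> first | rfl | exact absurd h (by decide)

theorem mem_localSpan {V : Finset (F2 n)} {x : F2 n} :
    x ∈ localSpan V ↔ ∀ i, x.at i = 0 ∨ ∃ v ∈ V, x.at i = v.at i := by
  simp [localSpan]

theorem subset_localSpan (V : Finset (F2 n)) : V ⊆ localSpan V := fun v hv =>
  mem_localSpan.mpr fun _ => Or.inr ⟨v, hv, rfl⟩

theorem localSpan_subset_productGroup {V : Finset (F2 n)} {P : Fin n → Axis}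
    (h : V ⊆ productGroup P) : localSpan V ⊆ productGroup P := by
  intro x hx
  refine mem_productGroup.mpr fun i => ?_
  rcases mem_localSpan.mp hx i with h0 | ⟨v, hv, hxv⟩
  · exact Or.inl h0
  · rw [hxv]
    exact mem_productGroup.mp (h hv) i

theorem localNoncommuting_eq_zero {P : Fin n → Axis} {x y : F2 n} (hx : x ∈ productGroup P)
    (hy : y ∈ productGroup P) : localNoncommuting x y = 0 := by
  have h0 : pauli 0 = 1 := by simp [pauli]
  rw [localNoncommuting, Finset.card_eq_zero, Finset.filter_eq_empty_iff]
  intro i _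
  rw [not_not]
  rcases mem_productGroup.mp hx i with h | h <;> rcases mem_productGroup.mp hy i with h' | h' <;>
    simp [h, h', h0]

theorem two_pow_card_le_card_localSpan {V : Finset (F2 n)} {P : Fin n → Axis}
    (h : V ⊆ productGroup P) (U : Finset (Fin n)) (hU : ∀ i ∈ U, ∃ v ∈ V, v.at i ≠ 0) :
    2 ^ U.card ≤ (localSpan V).card := by
  classical
  rw [← Finset.card_powerset]
  refine Finset.card_le_card_of_injOn (fun T => groupElement P fun i => decide (i ∈ T)) ?_ ?_
  · intro T hT
    refine mem_localSpan.mpr fun i => ?_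
    rw [groupElement_at]
    by_cases hi : i ∈ T
    · obtain ⟨v, hv, hvi⟩ := hU i (Finset.mem_powerset.mp hT hi)
      exact Or.inr ⟨v, hv, by
        simpa [hi] using ((mem_productGroup.mp (h hv) i).resolve_left hvi).symm⟩
    · exact Or.inl (by simp [hi])
  · intro T _ T' _ hTT
    have := groupElement_injective P hTT
    ext i
    simpa using congrFun this i

/-- Inside a product group an element is determined by its support. -/
theorem card_localSpan_le {V : Finset (F2 n)} {P : Fin n → Axis}
    (h : localSpan V ⊆ productGroup P) (K : Finset (Fin n))
    (hK : ∀ i, ∀ v ∈ V, v.at i ≠ 0 → i ∈ K) : (localSpan V).card ≤ 2 ^ K.card := by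
  classical
  rw [← Finset.card_powerset]
  refine Finset.card_le_card_of_injOn (fun x => Finset.univ.filter fun i => x.at i ≠ 0) ?_ ?_
  · intro x hx
    refine Finset.mem_powerset.mpr fun i hi => ?_
    have hxi := (Finset.mem_filter.mp hi).2
    obtain ⟨v, hv, hxv⟩ := (mem_localSpan.mp hx i).resolve_left hxi
    exact hK i v hv (hxv ▸ hxi)
  · intro x hx y hy hxy
    refine F2.ext_at fun i => ?_
    have hi : x.at i ≠ 0 ↔ y.at i ≠ 0 := by simpa using Finset.ext_iff.mp hxy i
    rcases mem_productGroup.mp (h hx) i with h1 | h1 <;>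
      rcases mem_productGroup.mp (h hy) i with h2 | h2 <;>
      simp_all [(P i).label_ne_zero]

-- A qubit touched by V determines the axis there. At most t qubits are untouched, each with three
-- choices.
open Classical in
theorem card_filter_localSpan_subset_le (V : Finset (F2 n)) {t : ℝ}
    (h : (n : ℝ) - t ≤ Real.logb 2 ((localSpan V).card : ℝ)) :
    ((Finset.univ.filter fun P : Fin n → Axis => localSpan V ⊆ productGroup P).card : ℝ) ≤
      (3 : ℝ) ^ t := by
  rcases (Finset.univ.filter fun P : Fin n → Axis =>
    localSpan V ⊆ productGroup P).eq_empty_or_nonempty with he | ⟨P₀, hP₀⟩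
  · rw [he]
    simp only [Finset.card_empty, Nat.cast_zero]
    positivity
  · replace hP₀ := (Finset.mem_filter.mp hP₀).2
    set K : Finset (Fin n) := Finset.univ.filter fun i => ∃ v ∈ V, v.at i ≠ 0 with hK
    have hcard : (localSpan V).card ≤ 2 ^ K.card :=
      card_localSpan_le hP₀ K fun i v hv hvi =>
        Finset.mem_filter.mpr ⟨Finset.mem_univ i, v, hv, hvi⟩
    have hpos : 0 < (localSpan V).card :=
      Finset.card_pos.mpr ⟨0, mem_localSpan.mpr fun i => Or.inl rfl⟩
    have hnK : (n : ℝ) - t ≤ K.card := by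
      refine h.trans ?_
      calc Real.logb 2 ((localSpan V).card : ℝ) ≤ Real.logb 2 (2 ^ K.card) :=
            Real.logb_le_logb_of_le one_lt_two (by exact_mod_cast hpos) (by exact_mod_cast hcard)
        _ = K.card := by rw [Real.logb_pow, Real.logb_self_eq_one one_lt_two, mul_one]
    have hagree : ∀ P : Fin n → Axis, localSpan V ⊆ productGroup P → ∀ i ∈ K, P i = P₀ i := by
      intro P hP i hi
      obtain ⟨v, hv, hvi⟩ := (Finset.mem_filter.mp hi).2
      have h1 := (mem_productGroup.mp (hP (subset_localSpan V hv)) i).resolve_left hvi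
      have h2 := (mem_productGroup.mp (hP₀ (subset_localSpan V hv)) i).resolve_left hvi
      exact Axis.label_injective (h1.symm.trans h2)
    have hle : (Finset.univ.filter fun P : Fin n → Axis => localSpan V ⊆ productGroup P).card ≤
        3 ^ (n - K.card) := by
      have h3 : Fintype.card ({i // i ∈ Kᶜ} → Axis) = 3 ^ (n - K.card) := by
        rw [Fintype.card_fun, Fintype.card_coe, Finset.card_compl, Fintype.card_fin]
        rfl
      rw [← h3, ← Finset.card_univ]
      refine Finset.card_le_card_of_injOn (fun P i => P i) (fun _ _ => Finset.mem_univ _) ?_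
      intro P hP Q hQ hPQ
      replace hP := (Finset.mem_filter.mp hP).2
      replace hQ := (Finset.mem_filter.mp hQ).2
      funext i
      by_cases hi : i ∈ K
      · rw [hagree P hP i hi, hagree Q hQ i hi]
      · exact congrFun hPQ ⟨i, Finset.mem_compl.mpr hi⟩
    have hKn : K.card ≤ n := by simpa using K.card_le_univ
    calc _ ≤ ((3 ^ (n - K.card) : ℕ) : ℝ) := by exact_mod_cast hle
      _ = (3 : ℝ) ^ ((n : ℝ) - K.card) := by
          rw [← Nat.cast_sub hKn, Real.rpow_natCast]
          push_cast
          rfl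
      _ ≤ (3 : ℝ) ^ t := Real.rpow_le_rpow_of_exponent_le (by norm_num) (by linarith)

theorem length_visited_le {m : ℕ} (k : ℕ) (t : ℝ) (W : Fin m → F2 n) :
    ((visited k t W).length : ℝ) ≤ m.choose k * (3 : ℝ) ^ t := by
  classical
  have hsum : ∀ (l : List (Finset (Fin m))) (g : Finset (Fin m) → List (Fin n → Axis)) (c : ℝ),
      (∀ C ∈ l, ((g C).length : ℝ) ≤ c) → ((l.flatMap g).length : ℝ) ≤ l.length * c := by
    intro l g c
    induction l with
    | nil => simp
    | cons C l ih =>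
      intro h
      have h1 := ih fun D hD => h D (List.mem_cons_of_mem _ hD)
      have h2 := h C List.mem_cons_self
      rw [List.flatMap_cons, List.length_append, List.length_cons]
      push_cast
      linarith
  unfold visited
  refine (hsum _ _ ((3 : ℝ) ^ t) fun C hC => ?_).trans ?_
  · rw [Finset.length_toList]
    refine card_filter_localSpan_subset_le _ ?_
    simpa using (List.mem_filter.mp hC).2
  · refine mul_le_mul_of_nonneg_right ?_ (by positivity)
    refine Nat.cast_le.mpr ((List.length_filter_le _ _).trans ?_)
    rw [Finset.length_toList]
    calc _ ≤ (Finset.powersetCard k (Finset.univ : Finset (Fin m))).card :=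
          Finset.card_le_card fun C hC => Finset.mem_powersetCard.mpr
            ⟨Finset.subset_univ _, ((commutationGraph W).mem_cliqueFinset_iff.mp hC).card_eq⟩
      _ = m.choose k := by rw [Finset.card_powersetCard, Finset.card_univ, Fintype.card_fin]

/-- Elements of one product group commute locally, so the covering samples form a clique. Its
vertices are sample indices, so repeated samples do not reduce its size. -/
theorem mem_visited_of_mem_coverEvent {m k : ℕ} {t : ℝ} {P : Fin n → Axis} {U : Finset (Fin n)}
    (hU : (n : ℝ) - t ≤ U.card) {W : Fin m → F2 n}
    (hW : W ∈ coverEvent (productGroup P) (fun i x => x.at i = 0) m k U) :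
    P ∈ visited k t W := by
  classical
  obtain ⟨C, hC, hCP, hcov⟩ := hW
  have hsub : C.image W ⊆ productGroup P := by
    intro x hx
    obtain ⟨j, hj, rfl⟩ := Finset.mem_image.mp hx
    exact hCP j hj
  unfold visited
  refine List.mem_flatMap.mpr ⟨C, List.mem_filter.mpr ⟨?_, ?_⟩, ?_⟩
  · refine Finset.mem_toList.mpr ((commutationGraph W).mem_cliqueFinset_iff.mpr ⟨?_, hC⟩)
    intro i hi j hj hij
    exact (SimpleGraph.fromRel_adj _ _ _).mpr
      ⟨hij, Or.inl (localNoncommuting_eq_zero (hCP i hi) (hCP j hj))⟩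
  · have h1 : 2 ^ U.card ≤ (localSpan (C.image W)).card :=
      two_pow_card_le_card_localSpan hsub U fun i hi => by
        obtain ⟨j, hj, hji⟩ := hcov i hi
        exact ⟨W j, Finset.mem_image_of_mem W hj, hji⟩
    have h2 : (U.card : ℝ) ≤ Real.logb 2 ((localSpan (C.image W)).card : ℝ) := by
      calc (U.card : ℝ) = Real.logb 2 (2 ^ U.card) := by
            rw [Real.logb_pow, Real.logb_self_eq_one one_lt_two, mul_one]
        _ ≤ _ := Real.logb_le_logb_of_le one_lt_two (by positivity) (by exact_mod_cast h1)
    have h3 := hU.trans h2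
    convert decide_eq_true h3
  · have h4 := localSpan_subset_productGroup hsub
    refine Finset.mem_toList.mpr (Finset.mem_filter.mpr ⟨Finset.mem_univ _, ?_⟩)
    convert h4

end Visited

/-! ### Analysis of the algorithm -/

section Algorithm

variable {n : ℕ} (ρ : Density (Qubits n))

theorem outcome_basisMeasurement_toReal (P : Fin n → Axis) (s : Fin n → Bool) :
    ((basisMeasurement P).outcome ρ s).toReal = fidelity ρ (basisState P s) := by
  have h : (basisMeasurement P).outcome ρ s = ENNReal.ofReal
      (Matrix.vecMulVec (basisState P s).vec (star (basisState P s).vec) * ρ.mat).trace.re := rfl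
  have h0 : 0 ≤ (Matrix.vecMulVec (basisState P s).vec (star (basisState P s).vec) *
      ρ.mat).trace.re := born_nonneg ((basisMeasurement P).posSemidef s) ρ.posSemidef
  rw [← trace_vecMulVec_mul, h, ENNReal.toReal_ofReal h0]

/-- The lists of estimates in which some estimate is off by more than `η`. -/
def inaccurate (η : ℝ) : Set (List (SP n × ℝ)) := {l | ∃ e ∈ l, η < |e.2 - fidelity ρ e.1|}

/-- The lists of estimates that do not contain the state `φ`. -/
def missing (φ : SP n) : Set (List (SP n × ℝ)) := {l | ∀ e ∈ l, e.1 ≠ φ}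

theorem estimate_inaccurate_le (m : ℕ) {η l : ℝ} (hη : 0 < η) (hl : 2 ≤ l)
    (hm : 2 * l / η ^ 2 ≤ m) (P : Fin n → Axis) :
    (estimate m ρ P).toOuterMeasure (inaccurate ρ η) ≤ ENNReal.ofReal (Real.exp (-l)) := by
  have h := expect_exists_deviation_le ((basisMeasurement P).outcome ρ) m hη hl hm
  refine le_trans (le_of_eq (toOuterMeasure_bind_pure _ _ _)) ?_
  rw [toOuterMeasure_iid]
  refine ENNReal.ofReal_le_ofReal (le_trans (expect_mono _ m fun v => ?_) h)
  refine Set.indicator_le_indicator_of_subset ?_ (fun _ => zero_le_one) v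
  rintro v ⟨e, he, hdev⟩
  obtain ⟨s, -, rfl⟩ := List.mem_map.mp he
  refine ⟨s, ?_⟩
  rw [outcome_basisMeasurement_toReal]
  exact hdev

/-- Every state of the basis is listed, even one that was never observed. -/
theorem estimate_missing_eq_zero (m : ℕ) (P : Fin n → Axis) (s : Fin n → Bool) :
    (estimate m ρ P).toOuterMeasure (missing (basisState P s)) = 0 := by
  refine (toOuterMeasure_bind_pure _ _ _).trans ?_
  refine (congrArg _ (Set.eq_empty_of_forall_notMem fun v hv => ?_)).trans
    MeasureTheory.measure_empty
  exact hv _ (List.mem_map.mpr ⟨s, Finset.mem_toList.mpr (Finset.mem_univ s), rfl⟩) rfl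

theorem outerIteration_inaccurate_le {ε τ p δ l : ℝ} (hε : 0 < ε) (hl : 2 ≤ l)
    (hm : 8 * l / ε ^ 2 ≤ mEst n ε τ p δ) :
    (outerIteration ε τ p δ ρ).toOuterMeasure (inaccurate ρ (ε / 2)) ≤
      ENNReal.ofReal ((mClique n p τ).choose (cliqueSize n p) * (3 : ℝ) ^ tBound p τ *
        Real.exp (-l)) := by
  refine (toOuterMeasure_bind_le _ _ ∅ _ _ fun W _ => ?_).trans_eq (by
    rw [MeasureTheory.measure_empty, zero_add])
  refine (toOuterMeasure_bind_pure _ _ _).trans_le ?_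
  have h := toOuterMeasure_forEach_exists_le (estimate (mEst n ε τ p δ) ρ) (inaccurate ρ (ε / 2))
    _ (estimate_inaccurate_le ρ _ (half_pos hε) hl (le_trans (le_of_eq (by ring)) hm))
    (visited (cliqueSize n p) (tBound p τ) W)
  refine le_trans (MeasureTheory.OuterMeasure.mono _ ?_) (h.trans ?_)
  · rintro L ⟨e, he, hdev⟩
    obtain ⟨l, hl, hel⟩ := List.mem_flatten.mp he
    exact ⟨l, hl, e, hel, hdev⟩
  · rw [← ENNReal.ofReal_natCast, ← ENNReal.ofReal_mul (Nat.cast_nonneg _)]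
    exact ENNReal.ofReal_le_ofReal
      (mul_le_mul_of_nonneg_right (length_visited_le _ _ W) (Real.exp_pos _).le)

theorem pow_cliqueSize_le (hn : 0 < n) {p : ℝ} (hp : 0 < p) (hp1 : p < 1) :
    n * p ^ cliqueSize n p ≤ 1 / 2 := by
  have hn' : (0 : ℝ) < n := by exact_mod_cast hn
  have h : p ^ cliqueSize n p ≤ 1 / (2 * n) := by
    rw [← Real.rpow_natCast]
    calc p ^ (cliqueSize n p : ℝ) ≤ p ^ Real.logb p (1 / (2 * n)) :=
          Real.rpow_le_rpow_of_exponent_ge hp hp1.le (Nat.le_ceil _)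
      _ = 1 / (2 * n) := Real.rpow_logb hp hp1.ne (by positivity)
  calc n * p ^ cliqueSize n p ≤ n * (1 / (2 * n)) := mul_le_mul_of_nonneg_left h hn'.le
    _ = 1 / 2 := by field_simp

theorem iid_notMem_visited_le (hn : 0 < n) {τ p : ℝ} (hτ0 : 0 < τ) (hp : 1 / 2 < p) (hp1 : p < 1)
    (P : Fin n → Axis) (s : Fin n → Bool) (hf : τ ≤ fidelity ρ (basisState P s)) :
    (iid (bellDifferenceSampling ρ) (mClique n p τ)).toOuterMeasure
      {W | P ∉ visited (cliqueSize n p) (tBound p τ) W} ≤ ENNReal.ofReal (3 / 4) := by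
  classical
  set μ := bellDifferenceSampling ρ with hμ
  set k := cliqueSize n p with hk
  set m := mClique n p τ with hm
  set Q := ∑ x ∈ productGroup P, (μ x).toReal with hQ
  have hQτ : τ ^ 4 ≤ Q := (pow_le_pow_left₀ hτ0.le hf 4).trans
    (fidelity_pow_four_le ρ P s (hτ0.le.trans hf))
  have hQ0 : 0 < Q := (by positivity : 0 < τ ^ 4).trans_le hQτ
  have hQ1 : Q ≤ 1 := by
    rw [← sum_toReal μ]
    exact Finset.sum_le_sum_of_subset_of_nonneg (Finset.subset_univ _)
      fun _ _ _ => ENNReal.toReal_nonneg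
  -- The qubits to be covered: given the group, a sample is the identity there with probability at
  -- most p. The entropy bound controls the complement.
  set U : Finset (Fin n) := Finset.univ.filter fun i =>
    ∑ x ∈ productGroup P with x.at i = 0, (μ x).toReal ≤ p * Q with hU
  have hbad : (Uᶜ.card : ℝ) ≤ tBound p τ := by
    have h := card_mul_one_sub_entropy_le (fun z => (μ (groupElement P z)).toReal)
      (fun z => ENNReal.toReal_nonneg) (fun z => bellDifferenceSampling_le ρ _)
      (by rw [← sum_productGroup P fun x => (μ x).toReal]; exact hQ0) hp hp1 Uᶜ ?_
    · rw [← sum_productGroup P fun x => (μ x).toReal, ← hQ] at h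
      rw [tBound, le_div_iff₀ (by linarith [entropy_lt_one hp])]
      refine h.trans ?_
      calc Real.logb 2 (1 / Q) ≤ Real.logb 2 ((1 / τ) ^ 4) := by
            refine Real.logb_le_logb_of_le one_lt_two (by positivity) ?_
            rw [_root_.one_div_pow]
            exact one_div_le_one_div_of_le (by positivity) hQτ
        _ = 4 * Real.logb 2 (1 / τ) := by
            rw [Real.logb_pow]
            norm_num
    · intro i hi
      have hi' : ¬ ∑ x ∈ productGroup P with x.at i = 0, (μ x).toReal ≤ p * Q := by
        simpa [hU] using hi
      rw [Finset.sum_filter, sum_productGroup P fun x => if x.at i = 0 then (μ x).toReal else 0]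
        at hi'
      rw [← sum_productGroup P fun x => (μ x).toReal, ← hQ, Finset.sum_filter]
      refine (not_le.mp hi').le.trans (le_of_eq (Finset.sum_congr rfl fun z _ => ?_))
      rw [groupElement_at]
      cases z i <;> simp [(P i).label_ne_zero]
  have hUn : (n : ℝ) - tBound p τ ≤ U.card := by
    have : (Uᶜ.card : ℝ) = n - U.card := by
      rw [Finset.card_compl, Fintype.card_fin, Nat.cast_sub (by simpa using U.card_le_univ)]
    linarith
  have hcover := le_expect_exists_cover μ (productGroup P) p (by linarith)
    (fun (i : Fin n) x => x.at i = 0) m k U fun i hi => by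
      convert (Finset.mem_filter.mp hi).2
  -- The sample count makes the mean at least k + 1; the median bound needs only k.
  have hmean : (k : ℝ) ≤ m * Q := by
    have h1 : 1 / τ ^ 4 * ((k : ℝ) + 1) ≤ m := Nat.le_ceil _
    calc (k : ℝ) ≤ 1 / τ ^ 4 * (k + 1) * τ ^ 4 := by
          field_simp
          linarith
      _ ≤ m * Q := mul_le_mul h1 hQτ (by positivity) (Nat.cast_nonneg m)
  have htail := half_le_binomTail hQ0.le hQ1 hmean
  have hUk : (U.card : ℝ) * p ^ k ≤ 1 / 2 := by
    refine le_trans (mul_le_mul_of_nonneg_right ?_ (by positivity))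
      (pow_cliqueSize_le hn (by linarith) hp1)
    exact_mod_cast (by simpa using U.card_le_univ : U.card ≤ n)
  have hquarter : 1 / 4 ≤ expect μ m
      ((coverEvent (productGroup P) (fun (i : Fin n) x => x.at i = 0) m k U).indicator 1) := by
    refine le_trans ?_ hcover
    calc (1 : ℝ) / 4 = 1 / 2 * (1 / 2) := by norm_num
      _ ≤ _ := mul_le_mul htail (by linarith) (by norm_num) (by linarith)
  rw [toOuterMeasure_iid]
  refine ENNReal.ofReal_le_ofReal ?_
  set E := coverEvent (productGroup P) (fun (i : Fin n) x => x.at i = 0) m k U with hE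
  have hle : expect μ m ({W | P ∉ visited k (tBound p τ) W}.indicator 1) ≤
      expect μ m fun W => 1 + -1 * E.indicator 1 W := by
    refine expect_mono μ m fun W => ?_
    by_cases hW : W ∈ E
    · have := mem_visited_of_mem_coverEvent hUn hW
      simp [this, hW]
    · rw [Set.indicator_of_notMem hW, mul_zero, add_zero]
      exact Set.indicator_apply_le' (fun _ => le_rfl) fun _ => zero_le_one
  rw [expect_add μ m (fun _ => 1), expect_const, expect_const_mul] at hle
  have : expect μ m (E.indicator 1) = expect μ m fun W => E.indicator 1 W := rfl
  linarith

theorem outerIteration_missing_le (hn : 0 < n) {ε τ p δ : ℝ} (hτ0 : 0 < τ) (hp : 1 / 2 < p)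
    (hp1 : p < 1) (P : Fin n → Axis) (s : Fin n → Bool)
    (hf : τ ≤ fidelity ρ (basisState P s)) :
    (outerIteration ε τ p δ ρ).toOuterMeasure (missing (basisState P s)) ≤
      ENNReal.ofReal (3 / 4) := by
  refine (toOuterMeasure_bind_le _ _ {W | P ∉ visited (cliqueSize n p) (tBound p τ) W} _ 0
    fun W hW => ?_).trans ?_
  · refine (toOuterMeasure_bind_pure _ _ _).trans_le ?_
    have h := toOuterMeasure_forEach_forall_eq_zero (estimate (mEst n ε τ p δ) ρ)
      (missing (basisState P s)) (estimate_missing_eq_zero ρ _ P s)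
      (l := visited (cliqueSize n p) (tBound p τ) W) (not_not.mp hW)
    refine le_trans (MeasureTheory.OuterMeasure.mono _ ?_) h.le
    intro L hL l hl e he
    exact hL e (List.mem_flatten.mpr ⟨l, hl, he⟩)
  · rw [add_zero]
    exact iid_notMem_visited_le ρ hn hτ0 hp hp1 P s hf

/-- Since 3/4 > 1/2 > δ/2, one factor 3/4 does not reach δ/2. The value 2 makes the logarithm in
`mEst` large enough for the concentration bound. -/
theorem two_le_mOuter {δ : ℝ} (hδ : 0 < δ) (hδ1 : δ < 1) : 2 ≤ mOuter δ := by
  rw [mOuter, Nat.succ_le_iff, Nat.lt_ceil, Real.lt_logb_iff_rpow_lt_of_base_lt_one (by norm_num)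
    (by norm_num) (by linarith)]
  norm_num
  linarith

theorem pow_mOuter_le {δ : ℝ} (hδ : 0 < δ) : (3 / 4 : ℝ) ^ mOuter δ ≤ δ / 2 := by
  rw [← Real.rpow_natCast]
  calc (3 / 4 : ℝ) ^ (mOuter δ : ℝ) ≤ (3 / 4 : ℝ) ^ Real.logb (3 / 4) (δ / 2) :=
        Real.rpow_le_rpow_of_exponent_ge (by norm_num) (by norm_num) (Nat.le_ceil _)
    _ = δ / 2 := Real.rpow_logb (by norm_num) (by norm_num) (by linarith)

theorem cliqueSize_le_mClique {τ p : ℝ} (hτ0 : 0 < τ) (hτ : τ < 1) :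
    cliqueSize n p ≤ mClique n p τ := by
  have h1 : 1 / τ ^ 4 * ((cliqueSize n p : ℝ) + 1) ≤ mClique n p τ := Nat.le_ceil _
  have h2 : 1 ≤ 1 / τ ^ 4 := by
    rw [one_le_div (by positivity)]
    exact pow_le_one₀ hτ0.le hτ.le
  have h3 : (cliqueSize n p : ℝ) ≤ mClique n p τ := by nlinarith
  exact_mod_cast h3

/-- An error of ε/2 is paid twice, for the chosen state and for the optimal one. -/
theorem maxFidelity_sub_le_of_accurate (R : SelectionRule n) {ε : ℝ} {φ : SP n}
    (hφ : maxFidelity ρ = fidelity ρ φ) {l : List (SP n × ℝ)} (hacc : l ∉ inaccurate ρ (ε / 2))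
    (hmem : l ∉ missing φ) : maxFidelity ρ - ε ≤ fidelity ρ (R.pick l) := by
  simp only [inaccurate, missing, Set.mem_ofPred_eq, not_exists, not_and, not_lt, not_forall,
    not_not] at hacc hmem
  obtain ⟨e', he', rfl⟩ := hmem
  obtain ⟨e, he, hpick, hmax⟩ := R.pick_isMax l (List.ne_nil_of_mem he')
  have h1 := (abs_le.mp (hacc e he)).2
  have h2 := (abs_le.mp (hacc e' he')).1
  have h3 := hmax e' he'
  rw [hpick, hφ]
  linarith

theorem algorithm_failure_le (hn : 0 < n) {ε τ p δ : ℝ} (hε : 0 < ε) (hτ0 : 0 < τ) (hτ : τ < 1)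
    (hp : 1 / 2 < p) (hp1 : p < 1) (hδ : 0 < δ) (hδ1 : δ < 1) (R : SelectionRule n)
    (P : Fin n → Axis) (s : Fin n → Bool) (hf : τ ≤ fidelity ρ (basisState P s))
    (hmax : maxFidelity ρ = fidelity ρ (basisState P s)) :
    (algorithm ε τ p δ R ρ).toOuterMeasure {φ | maxFidelity ρ - ε ≤ fidelity ρ φ}ᶜ ≤
      ENNReal.ofReal δ := by
  set φ := basisState P s
  set μ := outerIteration ε τ p δ ρ with hμ
  set N := (mClique n p τ).choose (cliqueSize n p) * (3 : ℝ) ^ tBound p τ with hN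
  set L := 4 * (mOuter δ : ℝ) * ((mClique n p τ).choose (cliqueSize n p) : ℝ)
    * (3 : ℝ) ^ tBound p τ / δ with hL
  have hLN : L = 4 * mOuter δ * N / δ := by rw [hL, hN]; ring
  have ht : 0 ≤ tBound p τ := by
    refine div_nonneg (mul_nonneg (by norm_num) (Real.logb_nonneg one_lt_two ?_))
      (by linarith [entropy_lt_one hp])
    rw [one_le_div hτ0]
    exact hτ.le
  have hN1 : 1 ≤ N := by
    have h1 : 1 ≤ ((mClique n p τ).choose (cliqueSize n p) : ℝ) := by
      exact_mod_cast Nat.choose_pos (cliqueSize_le_mClique hτ0 hτ)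
    exact one_le_mul_of_one_le_of_one_le h1 (Real.one_le_rpow (by norm_num) ht)
  have hmo : (2 : ℝ) ≤ mOuter δ := by exact_mod_cast two_le_mOuter hδ hδ1
  have hL8 : 8 ≤ L := by
    rw [hLN, le_div_iff₀ hδ]
    nlinarith
  -- Because e² < 8.
  have hl : 2 ≤ Real.log L := by
    rw [Real.le_log_iff_exp_le (by linarith)]
    have h1 := Real.exp_one_lt_d9
    have h2 : Real.exp 2 = Real.exp 1 * Real.exp 1 := by rw [← Real.exp_add]; norm_num
    nlinarith [Real.exp_pos 1]
  have hacc := outerIteration_inaccurate_le ρ (δ := δ) (τ := τ) (p := p) hε hl (Nat.le_ceil _)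
  have hmiss := outerIteration_missing_le ρ (ε := ε) (δ := δ) hn hτ0 hp hp1 P s hf
  have halg : (algorithm ε τ p δ R ρ).toOuterMeasure {φ | maxFidelity ρ - ε ≤ fidelity ρ φ}ᶜ ≤
      (iid μ (mOuter δ)).toOuterMeasure ({runs | ∃ j, runs j ∈ inaccurate ρ (ε / 2)} ∪
        {runs | ∀ j, runs j ∈ missing φ}) := by
    refine (toOuterMeasure_bind_pure _ _ _).trans_le (MeasureTheory.OuterMeasure.mono _ ?_)
    intro runs hruns
    by_contra hcon
    simp only [Set.mem_union, Set.mem_ofPred_eq, not_or, not_exists, not_forall] at hcon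
    obtain ⟨hgood, j, hj⟩ := hcon
    refine hruns (maxFidelity_sub_le_of_accurate ρ R hmax ?_ ?_)
    · rintro ⟨e, he, hdev⟩
      obtain ⟨l, hl, hel⟩ := List.mem_flatten.mp he
      obtain ⟨i, rfl⟩ := (List.mem_ofFn' _ _).mp hl
      exact hgood i ⟨e, hel, hdev⟩
    · intro hall
      exact hj fun e he => hall e
        (List.mem_flatten.mpr ⟨_, (List.mem_ofFn' _ _).mpr ⟨j, rfl⟩, he⟩)
  refine halg.trans ((MeasureTheory.measure_union_le _ _).trans ?_)
  calc _ ≤ (mOuter δ : ENNReal) * ENNReal.ofReal (N * Real.exp (-Real.log L)) +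
        ENNReal.ofReal (3 / 4) ^ mOuter δ := by
        refine add_le_add ((toOuterMeasure_iid_exists_le _ _ _).trans ?_)
          ((toOuterMeasure_iid_forall_le _ _ _).trans ?_)
        · gcongr
        · gcongr
    _ ≤ ENNReal.ofReal (δ / 2) + ENNReal.ofReal (δ / 2) := by
        refine add_le_add ?_ ?_
        · rw [← ENNReal.ofReal_natCast, ← ENNReal.ofReal_mul (Nat.cast_nonneg _)]
          refine ENNReal.ofReal_le_ofReal ?_
          rw [Real.exp_neg, Real.exp_log (by linarith), hLN]
          -- The factor 4 in `mEst` brings the union bound down to δ/4, half of what is allowed.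
          have : (mOuter δ : ℝ) * (N * (4 * mOuter δ * N / δ)⁻¹) = δ / 4 := by
            field_simp
          rw [this]
          linarith
        · rw [← ENNReal.ofReal_pow (by norm_num)]
          exact ENNReal.ofReal_le_ofReal (pow_mOuter_le hδ)
    _ = ENNReal.ofReal δ := by
        rw [← ENNReal.ofReal_add (by linarith) (by linarith), add_halves]

end Algorithm

end StabProd

theorem mainTheorem2 (n : ℕ) (hn : 0 < n) (ε τ p δ : ℝ)
    (hε : 0 < ε) (hετ : ε ≤ τ) (hτ : τ < 1) (hp : 1 / 2 < p) (hp1 : p < 1)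
    (hδ : 0 < δ) (hδ1 : δ < 1)
    (ρ : StabProd.Density (StabProd.Qubits n))
    (hρ : ∃ φ : StabProd.SP n, τ ≤ StabProd.fidelity ρ φ)
    (R : StabProd.SelectionRule n) :
    ENNReal.ofReal (1 - δ) ≤
      (StabProd.algorithm ε τ p δ R ρ).toOuterMeasure
        {φ | StabProd.maxFidelity ρ - ε ≤ StabProd.fidelity ρ φ} := by
  obtain ⟨φ, -, hφ⟩ := Finset.exists_mem_eq_sup' (s := Finset.univ)
    ⟨fun _ => (StabProd.Axis.Z, false), Finset.mem_univ _⟩ (StabProd.fidelity ρ)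
  obtain ⟨φ₀, hφ₀⟩ := hρ
  have hf : τ ≤ StabProd.fidelity ρ φ := by
    rw [← hφ]
    exact hφ₀.trans (Finset.le_sup' (StabProd.fidelity ρ) (Finset.mem_univ φ₀))
  -- Splitting φ into axes and signs gives back φ definitionally as a `basisState`; `ε ≤ τ` supplies
  -- 0 < τ.
  have h := StabProd.algorithm_failure_le ρ hn hε (hε.trans_le hετ) hτ hp hp1 hδ hδ1 R
    (fun i => (φ i).1) (fun i => (φ i).2) hf hφ
  rw [ENNReal.ofReal_sub _ hδ.le, ENNReal.ofReal_one]
  exact (tsub_le_tsub_left h 1).trans (StabProd.one_sub_toOuterMeasure_compl_le _ _)
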